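/- **Conventions.** Let $q$ be a prime power and $V$ an $n$-dimensional vector space over $GF(q)$; $PG(n-1,q)$ is the projective space whose points are the $1$-dimensional subspaces of $V$. Subspaces of $V$ are identified with their sets of points, and $\dim$ denotes vector space dimension (so lines have dimension $2$, planes dimension $3$). A *geometry* $\mathcal G$ consists of a set of points and certain subsets of it, called lines, such that any two distinct points are on at most one line, each line has at least three points, and each point is on at least three lines. Its *point graph* joins two points when they are distinct and collinear. A connected graph with distance function $\mathrm d$ is *metrically regular* if the number of vertices at distance $i$ from $x$ depends only on $i$, and if, whenever $\mathrm d(x,y)=i$, the numbers of vertices at distance $1$ from $x$ and at distance $i-1$ (respectively $i$, $i+1$) from $y$ depend only on $i$. Let $\partial$ be the distance in the incidence graph of points and lines of $\mathcal G$. Then $\mathcal G$ is a *generalized hexagon* if $\partial(a,b)\le 6$ for all elements (points or lines) $a,b$, with equality for some $a,b$, and if there is a unique shortest path from $a$ to $b$ whenever $\partial(a,b)<6$. It has *parameters* $s,t$ if each line has exactly $s+1$ points and each point is on exactly $t+1$ lines. A *symplectic polarity* is the map $U\mapsto U^\perp$ on the subspaces of $V$ for some nondegenerate alternating bilinear form on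 $V$; a subspace $U$ is *totally isotropic* if $U\subseteq U^\perp$. The notation $x\leftrightarrow W(x)$ is a symplectic polarity means that $W(x)$ is defined for every point $x$ of $PG(n-1,q)$ and $W(x)=x^\perp$ for one such form. **Theorem 3.1.** Let $\mathcal G$ be a geometry with point set $\Omega$ and point graph $\Gamma$. For $x\in\Omega$ let $W_i(x)$ be the set of points of $\mathcal G$ at distance at most $i$ from $x$ in $\Gamma$. Assume that, for all $x\in\Omega$: (a) $\Omega$ is a set of points spanning $PG(n-1,q)$; (b) each line of $\mathcal G$ is a line of $PG(n-1,q)$; (c) $\Omega$ is the union of the set of lines of $\mathcal G$; (d) $\Gamma$ is metrically regular with diameter $d\ge 2$; (e) $W_1(x)$ is a subspace of $PG(n-1,q)$; (f) for each $i$ with $0\le i\le d$, $W_i(x)=\Omega\cap U_i(x)$ for some subspace $U_i(x)$; (g) $|W_2(x)|=(q^h-1)/(q-1)$ for some $h$. Then one of the following holds: (i) $d=2$, the map $x\leftrightarrow W_1(x)$ is a symplectic polarity, and $\mathcal G$ consists of its totally isotropic points and lines (so $\Omega$ is the set of all points of $PG(n-1,q)$); (ii) $d=3$, $\mathcal G$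 is a generalized hexagon with parameters $q,q$, and $\dim W_1(x)=3$ for each $x\in\Omega$. Moreover, in this case, if $W_2(x)$ and $W_3(x)$ are subspaces for all $x\in\Omega$, then $n=6$ and $x\leftrightarrow W_2(x)$ is a symplectic polarity. -/

import Mathlib

open scoped LinearAlgebra.Projectivization

/-- A geometry: a set of points, certain subsets of which are called lines, such that any two
points are on at most one line, each line has at least three points, and each point is on at least
three lines. -/
structure PointLineGeometry (P : Type*) where
  points : Set P
  lines : Set (Set P)
  line_subset : ∀ L ∈ lines, L ⊆ points
  line_unique : ∀ L ∈ lines, ∀ M ∈ lines, ∀ x y : P,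
    x ≠ y → x ∈ L → y ∈ L → x ∈ M → y ∈ M → L = M
  three_le_line : ∀ L ∈ lines, 3 ≤ L.encard
  three_le_pencil : ∀ x ∈ points, 3 ≤ {L ∈ lines | x ∈ L}.encard

namespace PointLineGeometry

variable {P : Type*} (G : PointLineGeometry P)

/-- The point graph: two points are joined when they are distinct and collinear. -/
def pointGraph : SimpleGraph G.points where
  Adj x y := x ≠ y ∧ ∃ L ∈ G.lines, (x : P) ∈ L ∧ (y : P) ∈ L
  symm := ⟨fun _ _ h => ⟨h.1.symm, h.2.imp fun _ hL => ⟨hL.1, hL.2.2, hL.2.1⟩⟩⟩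
  loopless := ⟨fun _ h => h.1 rfl⟩

/-- `G.W i x` is the set of points at distance at most `i` from `x` in the point graph. -/
def W (i : ℕ) (x : G.points) : Set P :=
  Subtype.val '' {y : G.points | G.pointGraph.edist x y ≤ i}

/-- Incidence between the elements (points and lines) of the geometry. -/
def Incident : G.points ⊕ G.lines → G.points ⊕ G.lines → Prop
  | Sum.inl x, Sum.inr L => (x : P) ∈ (L : Set P)
  | Sum.inr L, Sum.inl x => (x : P) ∈ (L : Set P)
  | _, _ => False

/-- The incidence graph; its walks are the sequences of successively incident elements. -/
def incidenceGraph : SimpleGraph (G.points ⊕ G.lines) where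
  Adj := G.Incident
  symm := ⟨by rintro (x | L) (y | M) h <;> exact h⟩
  loopless := ⟨by rintro (x | L) h <;> exact h⟩

/-- Generalized `n`-gons. -/
structure IsGeneralizedPolygon (n : ℕ) : Prop where
  three_le : 3 ≤ n
  unique_shortest : ∀ a b, G.incidenceGraph.edist a b < n →
    ∃! p : G.incidenceGraph.Walk a b, (p.length : ℕ∞) = G.incidenceGraph.edist a b
  edist_le : ∀ a b, G.incidenceGraph.edist a b ≤ n
  exists_edist_eq : ∃ a b, G.incidenceGraph.edist a b = n

/-- Each line has exactly `s + 1` points and each point is on exactly `t + 1` lines. -/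
def HasParameters (s t : ℕ) : Prop :=
  (∀ L ∈ G.lines, L.encard = s + 1) ∧ ∀ x ∈ G.points, {L ∈ G.lines | x ∈ L}.encard = t + 1

end PointLineGeometry

/-- Metrically regular (distance-regular) graphs. -/
structure IsMetricallyRegular {X : Type*} (Γ : SimpleGraph X) : Prop where
  connected : Γ.Connected
  card_sphere : ∀ (i : ℕ) (x x' : X),
    {z | Γ.dist x z = i}.encard = {z | Γ.dist x' z = i}.encard
  card_inter : ∀ (i j : ℕ), (j + 1 = i ∨ j = i ∨ j = i + 1) → ∀ x y x' y' : X,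
    Γ.dist x y = i → Γ.dist x' y' = i →
      {z | Γ.dist x z = 1 ∧ Γ.dist y z = j}.encard =
        {z | Γ.dist x' z = 1 ∧ Γ.dist y' z = j}.encard

section Projective

variable {K V : Type*} [Field K] [AddCommGroup V] [Module K V]

/-- The set of points of the projective space of `V` lying in the subspace `U`. -/
def pointsOf (U : Submodule K V) : Set (ℙ K V) := {p | p.submodule ≤ U}

/-- `S` is (the point set of) a subspace of vector space dimension `k`. -/
def IsProjSubspaceOfDim (k : ℕ) (S : Set (ℙ K V)) : Prop :=
  ∃ U : Submodule K V, Module.finrank K U = k ∧ S = pointsOf U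

/-- `S` is (the point set of) a subspace. -/
def IsProjSubspace (S : Set (ℙ K V)) : Prop :=
  ∃ U : Submodule K V, S = pointsOf U

/-- A polarity: an inclusion-reversing map on subspaces that is its own inverse. -/
def IsPolarity (π : Submodule K V → Submodule K V) : Prop :=
  (∀ U U', U ≤ U' → π U' ≤ π U) ∧ ∀ U, π (π U) = U

/-- A symplectic polarity: one given by orthogonality for a nondegenerate alternating form. -/
def IsSymplecticPolarity (π : Submodule K V → Submodule K V) : Prop :=
  IsPolarity π ∧ ∃ B : LinearMap.BilinForm K V, B.IsAlt ∧ B.Nondegenerate ∧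
    ∀ U, π U = B.orthogonal U

end Projective

/-! Write `S x` for the subspace W_1(x). All its points belong to the geometry, so its meet with
U_i(y) is exactly the set of points within distance 1 of x and i of y. Metric regularity therefore
makes the dimensions of these meets depend only on i when d(x,y) is i or i+1. Let e be the dimension
of a unit ball, and m, f those of the meet of two unit balls whose centres are at distance 1, 2.

Counting the edges between the spheres of radius 1 and 2, and using that a ball of radius 2 has as
many points as a projective space of some dimension h, gives (q^h - q^e)(q^f - 1) = (q^e - q)(q^e -
q^m). Divisibility by q leaves only m = e - 1 together with f = e - 1, h = e + 1 or with f = 1, h =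
2e - 1 (`dimensions_of_count`, `dimensions`).

If f = e - 1, two hyperplanes of a common unit ball meet because e ≥ 3, so d = 2. Any two unit balls
then meet in a hyperplane of each, which forces all points into the span of one ball and one further
point (`point_le_sup`). Hence n = e + 1, a count shows that every projective point occurs, and the
symmetric map from points to hyperplanes is a symplectic polarity (`exists_isSymplecticPolarity`).

If f = 1, the same two hyperplanes give e = 3. The meets of `S x` with U_i(y) then have dimensions 1
and 2 before the diameter is reached, and the point graph has the intersection numbers of a
generalized 2d-gon or (2d+1)-gon of order (q, q). The Feit-Higman argument
(`feitHigman_of_order_eq`) makes an eigenvalue multiplicity integral, so a certain cosine would be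
rational unless the polygon is a 2d-gon with d ≤ 3; f = 1 rules out d = 2 (`hexagon_dimensions`).
The hexagon axioms follow by intersecting lines in the planes `S x`. If W_2 and W_3 are subspaces,
counting gives 1 + q + ... + q^5 points, so n = 6 and W_2(x) is a hyperplane, and the polarity
construction applies again. -/

/-! ### Points, subspaces and dimensions in projective space. -/

section ProjectiveBasics

variable {K V : Type*} [Field K] [AddCommGroup V] [Module K V]

theorem mem_pointsOf {U : Submodule K V} {p : ℙ K V} : p ∈ pointsOf U ↔ p.submodule ≤ U := Iff.rfl

theorem Projectivization.submodule_le_iff (p : ℙ K V) (U : Submodule K V) :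
    p.submodule ≤ U ↔ p.rep ∈ U := by
  rw [p.submodule_eq, Submodule.span_singleton_le_iff_mem]

theorem Projectivization.eq_of_submodule_le {p r : ℙ K V} (h : p.submodule ≤ r.submodule) :
    p = r := by
  apply Projectivization.submodule_injective
  have : FiniteDimensional K r.submodule :=
    Module.finite_of_finrank_eq_succ r.finrank_submodule
  exact Submodule.eq_of_le_of_finrank_eq h (by simp [Projectivization.finrank_submodule])

theorem pointsOf_subset_iff {U U' : Submodule K V} : pointsOf U ⊆ pointsOf U' ↔ U ≤ U' := by
  refine ⟨fun h v hv => ?_, fun h p hp => le_trans hp h⟩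
  by_cases h0 : v = 0
  · simp [h0]
  have h1 : Projectivization.mk K v h0 ∈ pointsOf U := by
    simpa [mem_pointsOf, Projectivization.submodule_mk] using hv
  simpa [mem_pointsOf, Projectivization.submodule_mk] using h h1

theorem pointsOf_injective : Function.Injective (pointsOf : Submodule K V → Set (ℙ K V)) :=
  fun _ _ h => le_antisymm (pointsOf_subset_iff.1 h.subset) (pointsOf_subset_iff.1 h.superset)

theorem pointsOf_top : pointsOf (⊤ : Submodule K V) = Set.univ := by
  ext p; simp [mem_pointsOf]

/-- A nonzero subspace contains a point. -/
theorem exists_mem_pointsOf {U : Submodule K V} (h : U ≠ ⊥) : ∃ p : ℙ K V, p.submodule ≤ U := by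
  obtain ⟨v, hv, h0⟩ := Submodule.exists_mem_ne_zero_of_ne_bot h
  exact ⟨Projectivization.mk K v h0, by simpa [Projectivization.submodule_mk] using hv⟩

/-- A subspace not inside another one has a point outside it. -/
theorem exists_point_le_not_le {U U' : Submodule K V} (h : ¬ U ≤ U') :
    ∃ p : ℙ K V, p.submodule ≤ U ∧ ¬ p.submodule ≤ U' := by
  by_contra! hc
  exact h (pointsOf_subset_iff.1 hc)

theorem range_map_subtype (U : Submodule K V) :
    Set.range (Projectivization.map U.subtype U.subtype_injective) = pointsOf U := by
  ext p
  constructor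
  · rintro ⟨r, rfl⟩
    induction r using Projectivization.ind with
    | h v hv => simp [mem_pointsOf, Projectivization.map_mk, Projectivization.submodule_mk]
  · intro hp
    have hr := (p.submodule_le_iff U).1 hp
    refine ⟨Projectivization.mk K ⟨p.rep, hr⟩ (by simpa using p.rep_nonzero), ?_⟩
    simp [Projectivization.map_mk]

theorem ncard_pointsOf [Finite K] (U : Submodule K V) :
    (pointsOf U).ncard = ∑ i ∈ Finset.range (Module.finrank K U), Nat.card K ^ i := by
  rw [← range_map_subtype, ← Set.image_univ,
    Set.ncard_image_of_injective _ (Projectivization.map_injective _ U.subtype_injective),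
    Set.ncard_univ, Projectivization.card_of_finrank K U rfl]

theorem exists_point_of_finrank_pos {U : Submodule K V} (h : 0 < Module.finrank K U) :
    ∃ p : ℙ K V, p.submodule ≤ U :=
  exists_mem_pointsOf (by rintro rfl; simp at h)

variable [FiniteDimensional K V]

theorem finrank_sup_point (U : Submodule K V) (p : ℙ K V) (h : ¬ p.submodule ≤ U) :
    Module.finrank K ↥(U ⊔ p.submodule) = Module.finrank K U + 1 := by
  have h1 := Submodule.finrank_sup_add_finrank_inf_eq U p.submodule
  have h2 : U ⊓ p.submodule = ⊥ := by
    by_contra hne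
    obtain ⟨r, hr⟩ := exists_mem_pointsOf hne
    have := Projectivization.eq_of_submodule_le (hr.trans inf_le_right)
    exact h (this ▸ hr.trans inf_le_left)
  rw [h2, finrank_bot, p.finrank_submodule] at h1
  omega

theorem finrank_sup_points {p r : ℙ K V} (h : p ≠ r) :
    Module.finrank K ↥(p.submodule ⊔ r.submodule) = 2 := by
  rw [finrank_sup_point _ _ fun hle => h (Projectivization.eq_of_submodule_le hle).symm,
    p.finrank_submodule]

theorem two_le_finrank {U : Submodule K V} {p r : ℙ K V} (h : p ≠ r) (hp : p.submodule ≤ U)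
    (hr : r.submodule ≤ U) : 2 ≤ Module.finrank K U := by
  rw [← finrank_sup_points h]
  exact Submodule.finrank_mono (sup_le hp hr)

/-- The line through two points is the only two-dimensional subspace containing them. -/
theorem eq_sup_of_finrank_two {U : Submodule K V} {p r : ℙ K V} (hU : Module.finrank K U = 2)
    (h : p ≠ r) (hp : p.submodule ≤ U) (hr : r.submodule ≤ U) :
    U = p.submodule ⊔ r.submodule :=
  (Submodule.eq_of_le_of_finrank_eq (sup_le hp hr) (by rw [hU, finrank_sup_points h])).symm

theorem one_le_finrank {U : Submodule K V} {p : ℙ K V} (hp : p.submodule ≤ U) :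
    1 ≤ Module.finrank K U := by
  rw [← p.finrank_submodule]
  exact Submodule.finrank_mono hp

theorem eq_of_finrank_one {U : Submodule K V} {p r : ℙ K V} (hU : Module.finrank K U = 1)
    (hp : p.submodule ≤ U) (hr : r.submodule ≤ U) : p = r := by
  by_contra h
  have := two_le_finrank h hp hr
  omega

/-- Grassmann's inequality inside an ambient subspace. -/
theorem finrank_add_le_add_inf {A B C : Submodule K V} (hA : A ≤ C) (hB : B ≤ C) :
    Module.finrank K A + Module.finrank K B ≤ Module.finrank K C + Module.finrank K ↥(A ⊓ B) := by
  rw [← Submodule.finrank_sup_add_finrank_inf_eq]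
  exact Nat.add_le_add_right (Submodule.finrank_mono (sup_le hA hB)) _

instance Projectivization.finite_of_finiteDimensional [Finite K] : Finite (ℙ K V) := by
  have : Finite V := Module.finite_of_finite K
  infer_instance

/-- This is what lets a dimension be recovered from a number of points. -/
theorem geomSum_strictMono {q : ℕ} (hq : 2 ≤ q) :
    StrictMono fun k => ∑ i ∈ Finset.range k, q ^ i := by
  refine strictMono_nat_of_lt_succ fun k => ?_
  rw [Finset.sum_range_succ]
  have : 0 < q ^ k := by positivity
  omega

end ProjectiveBasics

/-! ### Symplectic polarities from symmetric assignments of hyperplanes to points. -/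

section PolarityConstruction

variable {K V : Type*} [Field K] [AddCommGroup V] [Module K V]

/-- A system of functionals whose kernels form a null polarity comes from an alternating form. -/
theorem exists_alt_form_of_functionals (φ : V → Module.Dual K V)
    (hself : ∀ v, φ v v = 0) (hsymm : ∀ v w, φ v w = 0 → φ w v = 0)
    (hne : ∀ v, v ≠ 0 → φ v ≠ 0) [Nontrivial V] :
    ∃ B : LinearMap.BilinForm K V, B.IsAlt ∧ ∀ v w, B v w = 0 ↔ φ v w = 0 := by
  classical
  -- By symmetry, a vector orthogonal to `u` and `v` is orthogonal to every combination of them, so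
  -- the kernels of `φ u` and `φ v` meet inside that of `φ w`.
  have hspan : ∀ u v w : V, (∃ a b : K, w = a • u + b • v) →
      ∃ a b : K, φ w = a • φ u + b • φ v := by
    rintro u v w ⟨a, b, rfl⟩
    have h := mem_span_of_iInf_ker_le_ker (L := ![φ u, φ v]) (K := φ (a • u + b • v)) (by
      intro z hz
      have hu : φ u z = 0 := by simpa using (Submodule.mem_iInf _).1 hz 0
      have hv : φ v z = 0 := by simpa using (Submodule.mem_iInf _).1 hz 1
      rw [LinearMap.mem_ker]
      apply hsymm
      simp [hsymm _ _ hu, hsymm _ _ hv])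
    rw [Matrix.range_cons, Matrix.range_cons, Matrix.range_empty, Set.union_empty,
      Set.singleton_union, Submodule.mem_span_pair] at h
    obtain ⟨a', b', h⟩ := h
    exact ⟨a', b', h.symm⟩
  obtain ⟨f, hf⟩ := exists_ne (0 : V)
  obtain ⟨e, he⟩ : ∃ e, φ f e ≠ 0 := by
    by_contra! h
    exact hne f hf (LinearMap.ext h)
  -- normalised functionals off the hyperplane of `f`
  let ψ : V → Module.Dual K V := fun v => (-(φ f v) / φ v f) • φ v
  have hoff : ∀ v, φ f v ≠ 0 → φ v f ≠ 0 := fun v hv h => hv (hsymm _ _ h)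
  have hψf : ∀ v, φ f v ≠ 0 → ψ v f = -φ f v := fun v hv => by
    simp [ψ, div_mul_cancel₀ _ (hoff v hv)]
  have hψ0 : ∀ v w, φ f v ≠ 0 → (ψ v w = 0 ↔ φ v w = 0) := fun v w hv => by
    simp [ψ, hv, hoff v hv]
  -- The combination `u` of `v` and `w` lying in the hyperplane of `f` has `φ u` in the span of `ψ
  -- v` and `ψ w`. Its value at `f` vanishes, which fixes the ratio of the coefficients; its value
  -- at `u` vanishes too, which then gives skewness.
  have hskew : ∀ v w, φ f v ≠ 0 → φ f w ≠ 0 → ψ v w = -ψ w v := by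
    intro v w hv hw
    by_cases hu : φ f w • v - φ f v • w = 0
    · have h1 : w = (φ f w / φ f v) • v := by
        have : φ f v • w = φ f w • v := (sub_eq_zero.1 hu).symm
        rw [div_eq_inv_mul, mul_smul, ← this, smul_smul, inv_mul_cancel₀ hv, one_smul]
      have h2 : ψ v w = 0 := (hψ0 v w hv).2 (by rw [h1]; simp [hself])
      have h3 : ψ w v = 0 := (hψ0 w v hw).2 (hsymm _ _ ((hψ0 v w hv).1 h2))
      rw [h2, h3, neg_zero]
    · obtain ⟨a, b, hab⟩ := hspan v w (φ f w • v - φ f v • w)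
        ⟨φ f w, -φ f v, by rw [neg_smul, sub_eq_add_neg]⟩
      set u := φ f w • v - φ f v • w with hudef
      have hfu : φ u f = 0 := hsymm _ _ (by simp [hudef, mul_comm])
      obtain ⟨a', b', hab'⟩ : ∃ a' b' : K, φ u = a' • ψ v + b' • ψ w := by
        refine ⟨a * (φ v f / -φ f v), b * (φ w f / -φ f w), ?_⟩
        have h1 := hoff v hv
        have h2 := hoff w hw
        rw [hab]
        simp only [ψ, smul_smul]
        congr 2 <;> field_simp
      have e1 : a' * φ f v + b' * φ f w = 0 := by
        have := hfu
        rw [hab'] at this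
        simp only [LinearMap.add_apply, LinearMap.smul_apply, hψf v hv, hψf w hw,
          smul_eq_mul] at this
        linear_combination -this
      have hvv : ψ v v = 0 := (hψ0 v v hv).2 (hself v)
      have hww : ψ w w = 0 := (hψ0 w w hw).2 (hself w)
      have e2 : b' * φ f w * ψ w v - a' * φ f v * ψ v w = 0 := by
        have := hself u
        rw [hab'] at this
        simp only [hudef, LinearMap.add_apply, LinearMap.smul_apply, map_sub, map_smul,
          smul_eq_mul, hvv, hww] at this
        linear_combination this
      have ha' : a' ≠ 0 := by
        rintro rfl
        have : b' = 0 := by simpa [hw] using e1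
        exact hne u hu (by rw [hab', this]; simp)
      have e3 : a' * φ f v * (ψ v w + ψ w v) = 0 := by
        linear_combination -e2 + ψ w v * e1
      have := (mul_eq_zero.1 e3).resolve_left (mul_ne_zero ha' hv)
      exact eq_neg_of_add_eq_zero_left this
  have hdense : Submodule.span K {v | φ f v ≠ 0} = ⊤ := by
    rw [eq_top_iff]
    intro v _
    by_cases hv : φ f v = 0
    · have : v = (v + e) - e := by simp
      rw [this]
      exact sub_mem (Submodule.subset_span (by simpa [hv] using he)) (Submodule.subset_span he)
    · exact Submodule.subset_span hv
  -- The form is defined by `ψ` on a basis avoiding the hyperplane of `f`; skewness then shows that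
  -- it agrees with `ψ` everywhere off that hyperplane.
  let b := Module.Basis.ofSpan hdense.ge
  have hb : ∀ i, φ f (b i) ≠ 0 := fun i =>
    Module.Basis.ofSpan_subset hdense.ge (Set.mem_range_self i)
  let B : LinearMap.BilinForm K V := b.constr K fun i => ψ (b i)
  have hext : ∀ g g' : Module.Dual K V, (∀ w, φ f w ≠ 0 → g w = g' w) → g = g' := by
    intro g g' h
    exact LinearMap.ext_on hdense h
  have hBψ : ∀ v, φ f v ≠ 0 → B v = ψ v := by
    intro v hv
    refine hext _ _ fun w hw => ?_
    have hlin : B.flip w = -ψ w := by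
      refine b.ext fun i => ?_
      rw [LinearMap.BilinForm.flip_apply, LinearMap.neg_apply, Module.Basis.constr_basis]
      exact hskew _ _ (hb i) hw
    have := LinearMap.congr_fun hlin v
    rw [LinearMap.BilinForm.flip_apply, LinearMap.neg_apply] at this
    rw [this, hskew v w hv hw]
  have hBf : ∀ v, B v f = -φ f v := by
    have : B.flip f = -φ f := hext _ _ fun w hw => by
      simp [hBψ w hw, hψf w hw]
    intro v
    simpa using LinearMap.congr_fun this v
  have hBskew : ∀ v w, B v w = -B w v := by
    have h1 : ∀ v, φ f v ≠ 0 → ∀ w, B v w = -B w v := fun v hv => by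
      have : B v = -B.flip v := hext _ _ fun w hw => by
        simp [hBψ v hv, hBψ w hw, hskew v w hv hw]
      intro w
      simpa using LinearMap.congr_fun this w
    intro v w
    have : B.flip w = -B w := hext _ _ fun v hv => by simp [h1 v hv w]
    simpa using LinearMap.congr_fun this v
  refine ⟨B, fun v => ?_, fun v w => ?_⟩
  · by_cases hv : φ f v = 0
    · have hve : φ f (v + e) ≠ 0 := by simpa [hv] using he
      have h1 : B (v + e) (v + e) = 0 := by rw [hBψ _ hve]; exact (hψ0 _ _ hve).2 (hself _)
      have h2 : B e e = 0 := by rw [hBψ _ he]; exact (hψ0 _ _ he).2 (hself _)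
      have h3 := hBskew v e
      simp only [map_add, LinearMap.add_apply] at h1
      linear_combination h1 - h2 - h3
    · rw [hBψ _ hv]; exact (hψ0 _ _ hv).2 (hself _)
  · by_cases hv : φ f v = 0
    · by_cases h0 : v = 0
      · subst h0
        have := hsymm w 0 (map_zero _)
        simp [this]
      have hve : φ f (v + e) ≠ 0 := by simpa [hv] using he
      -- Inside the hyperplane, `v` is a difference of two vectors outside it. Evaluating at `f`
      -- forces opposite coefficients, so `φ v` is a multiple of `B v`.
      obtain ⟨a, c, hac⟩ := hspan (v + e) e v ⟨1, -1, by simp⟩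
      obtain ⟨a', c', hac'⟩ : ∃ a' c' : K, φ v = a' • B (v + e) + c' • B e := by
        refine ⟨a * (φ (v + e) f / -φ f (v + e)), c * (φ e f / -φ f e), ?_⟩
        have h1 := hoff _ hve
        have h2 := hoff e he
        rw [hac, hBψ _ hve, hBψ _ he]
        simp only [ψ, smul_smul]
        congr 2 <;> field_simp
      have e1 : a' + c' = 0 := by
        have := hsymm _ _ hv
        rw [hac'] at this
        simp only [LinearMap.add_apply, LinearMap.smul_apply, hBf, map_add, hv,
          smul_eq_mul] at this
        have h2 : (a' + c') * φ f e = 0 := by linear_combination -this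
        exact (mul_eq_zero.1 h2).resolve_right he
      have h3 : φ v = a' • B v := by
        refine LinearMap.ext fun z => ?_
        rw [hac', eq_neg_of_add_eq_zero_right e1]
        simp only [LinearMap.add_apply, LinearMap.smul_apply, map_add, smul_eq_mul]
        ring
      have ha : a' ≠ 0 := fun h => hne v h0 (by rw [h3, h]; simp)
      simp [h3, ha]
    · rw [hBψ _ hv, hψ0 _ _ hv]

variable [FiniteDimensional K V]

/-- A symmetric assignment of hyperplanes to points, each point lying on its hyperplane, is a
symplectic polarity. -/
theorem exists_isSymplecticPolarity (H : ℙ K V → Submodule K V)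
    (hfin : ∀ x, Module.finrank K (H x) + 1 = Module.finrank K V)
    (hself : ∀ x, x.submodule ≤ H x)
    (hsymm : ∀ x y : ℙ K V, y.submodule ≤ H x → x.submodule ≤ H y) [Nontrivial V] :
    ∃ π : Submodule K V → Submodule K V, IsSymplecticPolarity π ∧
      ∀ x : ℙ K V, π x.submodule = H x := by
  classical
  have hker : ∀ x, ∃ g : Module.Dual K V, LinearMap.ker g = H x := fun x => by
    have hlt : H x < ⊤ := by
      rw [lt_top_iff_ne_top]
      intro h
      have := hfin x
      rw [h, finrank_top] at this
      omega
    obtain ⟨g, hg, hle⟩ := Submodule.exists_le_ker_of_lt_top (H x) hlt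
    refine ⟨g, (Submodule.eq_of_le_of_finrank_eq hle ?_).symm⟩
    have h1 := Module.Dual.finrank_ker_add_one_of_ne_zero hg
    have := hfin x
    omega
  choose g hg using hker
  -- The functional of each point is chosen with an arbitrary scalar, so `φ` need not be linear; the
  -- previous theorem corrects the scalars.
  let φ : V → Module.Dual K V := fun v =>
    if h : v = 0 then 0 else g (Projectivization.mk K v h)
  have hφ : ∀ v (h : v ≠ 0) w, φ v w = 0 ↔ w ∈ H (Projectivization.mk K v h) := fun v h w => by
    simp only [φ, dif_neg h, ← hg, LinearMap.mem_ker]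
  have hmem : ∀ v (h : v ≠ 0) (U : Submodule K V),
      v ∈ U ↔ (Projectivization.mk K v h).submodule ≤ U := fun v h U => by
    rw [Projectivization.submodule_mk, Submodule.span_singleton_le_iff_mem]
  obtain ⟨B, halt, hB⟩ := exists_alt_form_of_functionals φ
    (fun v => by
      by_cases h : v = 0
      · simp [h]
      · rw [hφ v h, hmem v h]; exact hself _)
    (fun v w hvw => by
      by_cases h : v = 0
      · simp [h]
      by_cases h' : w = 0
      · simp [φ, h']
      rw [hφ v h, hmem w h'] at hvw
      rw [hφ w h', hmem v h]
      exact hsymm _ _ hvw)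
    (fun v h h0 => by
      have : H (Projectivization.mk K v h) = ⊤ := by
        rw [eq_top_iff]
        intro w _
        rw [← hφ v h, h0]; rfl
      have h1 := hfin (Projectivization.mk K v h)
      rw [this, finrank_top] at h1
      omega)
  have hnd : B.Nondegenerate := by
    rw [LinearMap.BilinForm.nondegenerate_iff_ker_eq_bot, LinearMap.ker_eq_bot']
    intro v hv
    by_contra h
    have : H (Projectivization.mk K v h) = ⊤ := by
      rw [eq_top_iff]
      intro w _
      rw [← hφ v h, ← hB, hv]; rfl
    have h1 := hfin (Projectivization.mk K v h)
    rw [this, finrank_top] at h1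
    omega
  refine ⟨fun U => B.orthogonal U, ⟨⟨fun U U' h => ?_, fun U => ?_⟩, B, halt, hnd, fun _ => rfl⟩,
    fun x => ?_⟩
  · exact LinearMap.BilinForm.orthogonal_le h
  · exact LinearMap.BilinForm.orthogonal_orthogonal hnd halt.isRefl U
  · ext w
    rw [LinearMap.BilinForm.mem_orthogonal_iff, x.submodule_eq]
    have h1 := hφ x.rep x.rep_nonzero w
    rw [x.mk_rep, ← hB] at h1
    rw [← h1]
    constructor
    · exact fun h => h _ (Submodule.mem_span_singleton_self _)
    · intro h z hz
      obtain ⟨c, rfl⟩ := Submodule.mem_span_singleton.1 hz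
      simp [h]

end PolarityConstruction

/-! ### Eigenvalue multiplicities in the point graph of a polygon of order (q, q). -/

section FeitHigman

/-- The trace of an idempotent real matrix is a natural number. -/
theorem Matrix.exists_nat_trace_of_idempotent {X : Type*} [Fintype X] [DecidableEq X]
    (E : Matrix X X ℝ) (h : E * E = E) : ∃ r : ℕ, E.trace = r := by
  have hid : IsIdempotentElem (Matrix.toLin' E) := by
    rw [IsIdempotentElem, Module.End.mul_eq_comp, ← Matrix.toLin'_mul, h]
  have hp := LinearMap.IsProj.trace (LinearMap.IsIdempotentElem.isProj_range _ hid)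
  rw [Matrix.trace_toLin'_eq] at hp
  exact ⟨_, hp⟩

variable {X : Type*} [Fintype X] [DecidableEq X] (Γ : SimpleGraph X)

/-- Multiplicities of eigenvalues of a distance-regular graph with the intersection numbers of a
generalized polygon of order `(q, q)` are natural numbers, hence the norm of the standard sequence
is rational. -/
theorem exists_rat_standard_norm [Nonempty X] {q c y : ℝ} {d : ℕ} (hd : 2 ≤ d)
    (hq : 0 < q) (hc : 0 < c) (hdist : ∀ x y, Γ.dist x y ≤ d)
    (hA0 : ∀ (g : ℕ → ℝ) x, ∑ z with Γ.dist x z = 1, g (Γ.dist x z) = q * (q + 1) * g 1)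
    (hA1 : ∀ (g : ℕ → ℝ) x y i, Γ.dist x y = i + 1 → i + 1 < d →
      ∑ z with Γ.dist x z = 1, g (Γ.dist y z) = g i + (q - 1) * g (i + 1) + q ^ 2 * g (i + 2))
    (hAd : ∀ (g : ℕ → ℝ) x y, Γ.dist x y = d →
      ∑ z with Γ.dist x z = 1, g (Γ.dist y z) = c * g (d - 1) + (q ^ 2 + q - c) * g d)
    (hconn : Γ.Connected)
    (x : ℕ → ℝ) (hx0 : x 0 = 1) (hx1 : (q + 1) * x 1 = q * y + q - 1)
    (hrec : ∀ i, x (i + 2) = y * x (i + 1) - x i)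
    (hbd : c * q * x (d - 1) + (q ^ 2 + q - c) * x d = (q * y + q - 1) * x d) :
    ∃ r : ℚ, 1 + ∑ i ∈ Finset.Ico 1 d, (q + 1) / q * x i ^ 2 + (q + 1) / (q * c) * x d ^ 2 = r := by
  classical
  set t := q * y + q - 1 with ht
  -- The standard sequence of the eigenvalue `t`. The factor `q ^ i` turns its three-term recurrence
  -- into the Chebyshev recurrence `hrec`.
  let u : ℕ → ℝ := fun i => x i / q ^ i
  let γ : ℕ → ℝ := fun i => if i = d then c else 1
  have hu : ∀ a b, ∑ z with Γ.dist a z = 1, u (Γ.dist b z) = t * u (Γ.dist a b) := by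
    intro a b
    rcases Nat.eq_zero_or_pos (Γ.dist a b) with h | h
    · have hab : a = b := (hconn.dist_eq_zero_iff).1 h
      subst hab
      rw [hA0, SimpleGraph.dist_self]
      simp only [u, hx0, pow_zero, pow_one]
      rw [← hx1]
      field_simp
    · obtain ⟨i, hi⟩ : ∃ i, Γ.dist a b = i + 1 := ⟨Γ.dist a b - 1, by omega⟩
      rcases (hdist a b).lt_or_eq with hlt | heq
      · rw [hA1 u a b i hi (by omega), hi]
        simp only [u, hrec i, ht]
        field_simp
        ring
      · rw [hAd u a b heq, heq]
        obtain ⟨j, rfl⟩ : ∃ j, d = j + 1 := ⟨d - 1, by omega⟩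
        simp only [u, Nat.add_sub_cancel] at hbd ⊢
        field_simp
        linear_combination q ^ j * hbd
  -- For an eigenvector, the sum over a sphere about `a` is a multiple of the value at `a`. The
  -- multiple is the size of the sphere in the intersection array times `u i`, and is found by
  -- summing the eigenvector equation over successive spheres.
  have hs : ∀ v : X → ℝ, (∀ a, ∑ z with Γ.dist a z = 1, v z = t * v a) →
      ∀ a i, 1 ≤ i → i ≤ d → γ i * ∑ z with Γ.dist a z = i, v z = (q + 1) * q ^ (i - 1) * x i * v a := by
    intro v hv a
    have hs0 : ∑ z with Γ.dist a z = 0, v z = v a := by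
      have : (Finset.univ.filter fun z => Γ.dist a z = 0) = {a} := by
        ext z; simp [hconn.dist_eq_zero_iff, eq_comm]
      rw [this, Finset.sum_singleton]
    have hswap : ∀ i, t * ∑ z with Γ.dist a z = i, v z =
        ∑ w, v w * ∑ z with Γ.dist w z = 1, if Γ.dist a z = i then (1 : ℝ) else 0 := by
      intro i
      rw [Finset.mul_sum, Finset.sum_filter]
      calc _ = ∑ z, ∑ w, if Γ.dist a z = i ∧ Γ.dist z w = 1 then v w else 0 := by
            refine Finset.sum_congr rfl fun z _ => ?_
            split_ifs with h
            · rw [← hv z, Finset.sum_filter]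
              simp [h]
            · simp [h]
        _ = _ := by
            rw [Finset.sum_comm]
            refine Finset.sum_congr rfl fun w _ => ?_
            rw [Finset.sum_filter, Finset.mul_sum]
            refine Finset.sum_congr rfl fun z _ => ?_
            rw [Γ.dist_comm (u := w)]
            by_cases h1 : Γ.dist a z = i <;> by_cases h2 : Γ.dist z w = 1 <;> simp [h1, h2]
    have hcase : ∀ (g : ℕ → ℝ) w,
        (Γ.dist a w = 0 ∧ ∑ z with Γ.dist w z = 1, g (Γ.dist a z) = q * (q + 1) * g 1) ∨
        (∃ j, Γ.dist a w = j + 1 ∧ j + 1 < d ∧ ∑ z with Γ.dist w z = 1, g (Γ.dist a z) =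
          g j + (q - 1) * g (j + 1) + q ^ 2 * g (j + 2)) ∨
        (Γ.dist a w = d ∧ ∑ z with Γ.dist w z = 1, g (Γ.dist a z) =
          c * g (d - 1) + (q ^ 2 + q - c) * g d) := by
      intro g w
      rcases Nat.eq_zero_or_pos (Γ.dist a w) with h | h
      · have : a = w := (hconn.dist_eq_zero_iff).1 h
        subst this
        exact Or.inl ⟨h, hA0 g a⟩
      rcases (hdist a w).lt_or_eq with hlt | heq
      · refine Or.inr (Or.inl ⟨Γ.dist a w - 1, by omega, by omega, ?_⟩)
        exact hA1 g w a _ (by rw [Γ.dist_comm]; omega) (by omega)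
      · exact Or.inr (Or.inr ⟨heq, hAd g w a (by rw [Γ.dist_comm]; omega)⟩)
    have hsum : ∀ (A B C : ℝ) (i j k : ℕ) (T : X → ℝ),
        (∀ w, T w = A * (if Γ.dist a w = i then 1 else 0) + B * (if Γ.dist a w = j then 1 else 0)
          + C * (if Γ.dist a w = k then 1 else 0)) →
        ∑ w, v w * T w = A * ∑ z with Γ.dist a z = i, v z + B * ∑ z with Γ.dist a z = j, v z
          + C * ∑ z with Γ.dist a z = k, v z := by
      intro A B C i j k T hT
      simp only [Finset.sum_filter, Finset.mul_sum, ← Finset.sum_add_distrib, hT]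
      refine Finset.sum_congr rfl fun w _ => ?_
      split_ifs <;> ring
    have h1 : γ 1 * ∑ z with Γ.dist a z = 1, v z = (q + 1) * q ^ 0 * x 1 * v a := by
      have hγ1 : γ 1 = 1 := if_neg (by omega)
      rw [hγ1, one_mul, hv a, ← hx1]
      ring
    have h2 : γ 2 * ∑ z with Γ.dist a z = 2, v z = (q + 1) * q ^ 1 * x 2 * v a := by
      have e := hswap 1
      rw [hsum (q * (q + 1)) (q - 1) (γ 2) 0 1 2 _ fun w => ?_, hs0] at e
      · have hγ1 : γ 1 = 1 := if_neg (by omega)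
        rw [hγ1, one_mul, pow_zero, mul_one] at h1
        rw [h1] at e
        rw [hrec 0, hx0]
        linear_combination -e + (q + 1) * x 1 * v a * ht
      · rcases hcase (fun j => if j = 1 then 1 else 0) w with ⟨h, e⟩ | ⟨j, h, hj, e⟩ | ⟨h, e⟩
        · rw [e, h]; simp
        · have : γ (j + 1) = 1 := if_neg (by omega)
          rw [e, h]
          rcases j with _ | _ | j
          · simp
          · simpa using this.symm
          · simp
        · rw [e, h]
          have hd0 : d ≠ 0 := by omega
          have hd1 : d ≠ 1 := by omega
          by_cases hd2 : d = 2
          · subst hd2; simp [γ]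
          · have : d - 1 ≠ 1 := by omega
            simp [this, hd2, hd0, hd1]
    have h3 : ∀ i, i + 3 ≤ d → (q : ℝ) ^ 2 * ∑ z with Γ.dist a z = i + 1, v z
        + (q - 1) * ∑ z with Γ.dist a z = i + 2, v z
        + γ (i + 3) * ∑ z with Γ.dist a z = i + 3, v z
        = t * ∑ z with Γ.dist a z = i + 2, v z := by
      intro i hi
      rw [hswap (i + 2)]
      refine (hsum _ _ _ _ _ _ _ fun w => ?_).symm
      rcases hcase (fun j => if j = i + 2 then 1 else 0) w with ⟨h, e⟩ | ⟨j, h, hj, e⟩ | ⟨h, e⟩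
      · rw [e, h]; simp
      · have : γ (j + 1) = 1 := if_neg (by omega)
        rw [e, h]
        by_cases h1 : j = i + 2
        · subst h1; simp [this]
        by_cases h2 : j = i + 1
        · subst h2; simp
        by_cases h3 : j = i
        · subst h3; simp
        simp [h1, h2, h3]
      · rw [e, h]
        have hd1 : d ≠ i + 1 := by omega
        have hd2 : d ≠ i + 2 := by omega
        by_cases hd3 : d = i + 3
        · subst hd3; simp [γ]
        · have : d - 1 ≠ i + 2 := by omega
          simp [this, hd1, hd2, hd3]
    have key : ∀ i, (i + 1 ≤ d → γ (i + 1) * ∑ z with Γ.dist a z = i + 1, v z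
        = (q + 1) * q ^ i * x (i + 1) * v a) ∧ (i + 2 ≤ d →
        γ (i + 2) * ∑ z with Γ.dist a z = i + 2, v z = (q + 1) * q ^ (i + 1) * x (i + 2) * v a) := by
      intro i
      induction i with
      | zero => exact ⟨fun _ => h1, fun _ => h2⟩
      | succ i ih =>
        refine ⟨fun h => ih.2 h, fun h => ?_⟩
        have e1 := ih.1 (by omega)
        have e2 := ih.2 (by omega)
        have g1 : γ (i + 1) = 1 := if_neg (by omega)
        have g2 : γ (i + 2) = 1 := if_neg (by omega)
        rw [g1, one_mul] at e1
        rw [g2, one_mul] at e2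
        have e3 := h3 i (by omega)
        rw [e1, e2] at e3
        have e4 := hrec (i + 1)
        show γ (i + 3) * ∑ z with Γ.dist a z = i + 3, v z = (q + 1) * q ^ (i + 2) * x (i + 3) * v a
        simp only [add_assoc, Nat.reduceAdd] at e4
        rw [e4]
        linear_combination e3 + (q + 1) * q ^ (i + 1) * x (i + 2) * v a * ht
    intro i hi hid
    obtain ⟨k, rfl⟩ : ∃ k, i = k + 1 := ⟨i - 1, by omega⟩
    exact (key k).1 hid
  set κ := 1 + ∑ i ∈ Finset.Ico 1 d, (q + 1) / q * x i ^ 2 + (q + 1) / (q * c) * x d ^ 2 with hκ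
  have hκpos : 0 < κ := by
    have : 0 ≤ ∑ i ∈ Finset.Ico 1 d, (q + 1) / q * x i ^ 2 :=
      Finset.sum_nonneg fun i _ => by positivity
    have : 0 ≤ (q + 1) / (q * c) * x d ^ 2 := by positivity
    linarith
  -- The matrix of `u (Γ.dist a z)` acts on the eigenspace as the scalar `κ`. Its own columns are
  -- eigenvectors by `hu`, so `κ⁻¹` times it is idempotent, and its trace `card X / κ` is the
  -- multiplicity.
  have hF : ∀ v : X → ℝ, (∀ a, ∑ z with Γ.dist a z = 1, v z = t * v a) →
      ∀ a, ∑ z, u (Γ.dist a z) * v z = κ * v a := by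
    intro v hv a
    have hs0 : ∑ z with Γ.dist a z = 0, v z = v a := by
      have : (Finset.univ.filter fun z => Γ.dist a z = 0) = {a} := by
        ext z; simp [hconn.dist_eq_zero_iff, eq_comm]
      rw [this, Finset.sum_singleton]
    have hfib : ∑ z, u (Γ.dist a z) * v z =
        ∑ i ∈ Finset.range (d + 1), u i * ∑ z with Γ.dist a z = i, v z := by
      rw [← Finset.sum_fiberwise_of_maps_to (t := Finset.range (d + 1)) (g := fun z => Γ.dist a z)
        (fun z _ => Finset.mem_range.2 (Nat.lt_succ_of_le (hdist a z)))]
      refine Finset.sum_congr rfl fun i _ => ?_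
      rw [Finset.mul_sum]
      refine Finset.sum_congr rfl fun z hz => ?_
      rw [(Finset.mem_filter.1 hz).2]
    rw [hfib, Finset.sum_range_succ, Finset.range_eq_Ico,
      Finset.sum_eq_sum_Ico_succ_bot (by omega), hs0, hκ, add_mul, add_mul, Finset.sum_mul]
    congr 1
    · congr 1
      · simp [u, hx0]
      · refine Finset.sum_congr rfl fun i hi => ?_
        rw [Finset.mem_Ico] at hi
        have e := hs v hv a i (by omega) (by omega)
        have g1 : γ i = 1 := if_neg (by omega)
        rw [g1, one_mul] at e
        rw [e]
        obtain ⟨k, rfl⟩ : ∃ k, i = k + 1 := ⟨i - 1, by omega⟩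
        simp only [u, Nat.add_sub_cancel, pow_succ]
        field_simp
    · have e := hs v hv a d (by omega) le_rfl
      have g1 : γ d = c := if_pos rfl
      rw [g1] at e
      obtain ⟨k, rfl⟩ : ∃ k, d = k + 1 := ⟨d - 1, by omega⟩
      simp only [u, Nat.add_sub_cancel] at e ⊢
      field_simp
      linear_combination q * x (k + 1) * e
  let F : Matrix X X ℝ := Matrix.of fun a b => u (Γ.dist a b)
  have hFF : F * F = κ • F := by
    ext a b
    rw [Matrix.mul_apply, Matrix.smul_apply, smul_eq_mul]
    have := hF (fun z => u (Γ.dist b z)) (fun a' => by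
      rw [hu a' b, Γ.dist_comm]) a
    simp only [F, Matrix.of_apply]
    rw [Γ.dist_comm (u := a) (v := b), ← this]
    refine Finset.sum_congr rfl fun z _ => ?_
    rw [Γ.dist_comm (u := z)]
  have htr : F.trace = Fintype.card X := by
    simp [Matrix.trace, F, u, hx0]
  obtain ⟨r, hr⟩ := Matrix.exists_nat_trace_of_idempotent (κ⁻¹ • F) (by
    rw [Matrix.smul_mul, Matrix.mul_smul, hFF, smul_smul κ⁻¹ κ, inv_mul_cancel₀ hκpos.ne', one_smul])
  rw [Matrix.trace_smul, htr, smul_eq_mul] at hr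
  have hN : (0 : ℝ) < Fintype.card X := by exact_mod_cast Fintype.card_pos
  have hr0 : (r : ℝ) ≠ 0 := by
    rw [← hr]; positivity
  refine ⟨Fintype.card X / r, ?_⟩
  push_cast
  rw [eq_div_iff hr0, ← hr]
  field_simp

end FeitHigman

/-! ### The Feit-Higman restriction by rationality of cosines. -/

section FeitHigmanTrig

open Real

/-- Twice-angle telescoping of a sum of squares of a trigonometric sequence. -/
theorem sum_sq_cos_add_sin (φ β : ℝ) (n : ℕ) :
    4 * sin φ * ∑ i ∈ Finset.Ico 1 (n + 1), (cos (i * φ) + β * sin (i * φ)) ^ 2 =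
      2 * n * sin φ * (1 + β ^ 2) + (1 - β ^ 2) * (sin ((2 * n + 1) * φ) - sin φ)
        + 2 * β * (cos φ - cos ((2 * n + 1) * φ)) := by
  induction n with
  | zero => simp
  | succ n ih =>
    rw [Finset.sum_Ico_succ_top (by omega), mul_add, ih]
    push_cast
    set θ := (n + 1 : ℝ) * φ with hθ
    have h1 : (2 * (n : ℝ) + 1) * φ = 2 * θ - φ := by rw [hθ]; ring
    have h2 : (2 * ((n : ℝ) + 1) + 1) * φ = 2 * θ + φ := by rw [hθ]; ring
    rw [h1, h2, sin_sub, sin_add, cos_sub, cos_add, sin_two_mul, cos_two_mul]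
    have := sin_sq_add_cos_sq θ
    linear_combination 4 * sin φ * β ^ 2 * this

/-- The relation says `β * tan (φ / 2) = r`, and the cosine is a rational function of the squared
tangent of the half angle. -/
theorem cos_mem_of_sq_mem (F : Subfield ℝ) {r β φ : ℝ} (hr : r ∈ F) (hr0 : r ≠ 0)
    (hs : sin φ ≠ 0) (hβ : β * sin φ = r * (1 + cos φ)) (hβ2 : β ^ 2 ∈ F) : cos φ ∈ F := by
  have h0 : r ^ 2 + β ^ 2 ≠ 0 := by positivity
  have hs2 := sin_sq_add_cos_sq φ
  have h1 : 1 + cos φ ≠ 0 := by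
    intro h
    apply hs
    have : cos φ = -1 := by linarith
    rw [this] at hs2
    nlinarith
  have key : cos φ = (β ^ 2 - r ^ 2) / (r ^ 2 + β ^ 2) := by
    rw [eq_div_iff h0]
    apply mul_left_cancel₀ h1
    have : (β * sin φ) ^ 2 = (r * (1 + cos φ)) ^ 2 := by rw [hβ]
    linear_combination -this + β ^ 2 * hs2
  rw [key]
  exact div_mem (sub_mem hβ2 (pow_mem hr 2)) (add_mem (pow_mem hr 2) hβ2)

variable {X : Type*} [Fintype X] [DecidableEq X] (Γ : SimpleGraph X)

/-- The Feit–Higman theorem for generalized polygons of order `(q, q)`, in terms of the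
intersection numbers of the point graph. -/
theorem feitHigman_of_order_eq [Nonempty X] {q : ℕ} {c : ℝ} {d : ℕ} (hd : 2 ≤ d)
    (hq : 2 ≤ q) (hdist : ∀ x y, Γ.dist x y ≤ d)
    (hA0 : ∀ (g : ℕ → ℝ) x, ∑ z with Γ.dist x z = 1, g (Γ.dist x z) = q * (q + 1) * g 1)
    (hA1 : ∀ (g : ℕ → ℝ) x y i, Γ.dist x y = i + 1 → i + 1 < d →
      ∑ z with Γ.dist x z = 1, g (Γ.dist y z) = g i + (q - 1) * g (i + 1) + q ^ 2 * g (i + 2))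
    (hAd : ∀ (g : ℕ → ℝ) x y, Γ.dist x y = d →
      ∑ z with Γ.dist x z = 1, g (Γ.dist y z) = c * g (d - 1) + (q ^ 2 + q - c) * g d)
    (hconn : Γ.Connected) (hc : c = 1 ∨ c = q + 1) : c = q + 1 ∧ d ≤ 3 := by
  have hq2 : (2 : ℝ) ≤ q := by exact_mod_cast hq
  have hq0 : (0 : ℝ) < q := by linarith
  have hd2 : (2 : ℝ) ≤ d := by exact_mod_cast hd
  have hcpos : 0 < c := by rcases hc with h | h <;> rw [h] <;> linarith
  set r : ℝ := (q - 1) / (q + 1) with hr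
  have hrq : r * (q + 1) = q - 1 := by rw [hr]; field_simp
  have hr0 : r ≠ 0 := by
    rw [hr]; exact (div_pos (by linarith) (by linarith)).ne'
  -- The rational numbers inside `ℝ`. The norm of the standard sequence lies in `F`; its closed form
  -- puts `β ^ 2`, and hence `cos φ`, in `F`, against irrationality of the cosine.
  let F : Subfield ℝ := (Rat.castHom ℝ).fieldRange
  have hqF : (q : ℝ) ∈ F := natCast_mem F q
  have hrF : r ∈ F := div_mem (sub_mem hqF (one_mem F)) (add_mem hqF (one_mem F))
  have hdF : (d : ℝ) ∈ F := natCast_mem F d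
  have h2F : (2 : ℝ) ∈ F := by exact_mod_cast natCast_mem F 2
  have hirr : ∀ {s : ℚ} {φ : ℝ}, 3 < s.den → φ = s * π → cos φ ∉ F := by
    rintro s φ hs rfl ⟨t, ht⟩
    exact irrational_cos_rat_mul_pi hs ⟨t, ht⟩
  -- the standard sequence attached to an angle
  have main : ∀ φ : ℝ, sin φ ≠ 0 → ∀ β : ℝ, β * sin φ = r * (1 + cos φ) →
      (c * q * (cos ((d - 1 : ℕ) * φ) + β * sin ((d - 1 : ℕ) * φ)) +
        (q ^ 2 + q - c) * (cos (d * φ) + β * sin (d * φ)) =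
        (q * (2 * cos φ) + q - 1) * (cos (d * φ) + β * sin (d * φ))) →
      1 + (∑ i ∈ Finset.Ico 1 d, (q + 1) / q * (cos (i * φ) + β * sin (i * φ)) ^ 2) +
        (q + 1) / (q * c) * (cos (d * φ) + β * sin (d * φ)) ^ 2 ∈ F := by
    intro φ hs β hβ hbd
    obtain ⟨t, ht⟩ := exists_rat_standard_norm Γ hd hq0 hcpos hdist hA0 hA1 hAd hconn
      (fun i => cos (i * φ) + β * sin (i * φ)) (y := 2 * cos φ) (by simp)
      (by
        simp only [Nat.cast_one, one_mul]
        rw [hβ]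
        linear_combination (1 + cos φ) * hrq)
      (by
        intro i
        push_cast
        have e1 : ((i : ℝ) + 2) * φ = (i + 1) * φ + φ := by ring
        have e2 : (i : ℝ) * φ = (i + 1) * φ - φ := by ring
        rw [e1, e2, cos_add, cos_sub, sin_add, sin_sub]
        ring) hbd
    exact ⟨t, ht.symm⟩
  have hdpred : ((d - 1 : ℕ) : ℝ) = d - 1 := by
    rw [Nat.cast_sub (by omega), Nat.cast_one]
  rcases hc with rfl | rfl
  · exfalso
    -- For this angle `(d + 1) * φ = 2 * π - d * φ`, a reflection that makes the boundary equation
    -- at distance `d` hold.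
    set φ : ℝ := 2 * π / (2 * d + 1) with hφ
    have hφ' : (2 * d + 1) * φ = 2 * π := by rw [hφ]; field_simp
    have hφpos : 0 < φ := by positivity
    have hφlt : φ < π := by
      rw [hφ, div_lt_iff₀ (by positivity)]
      nlinarith [pi_pos]
    have hsin : sin φ ≠ 0 := (sin_pos_of_pos_of_lt_pi hφpos hφlt).ne'
    set β := r * (1 + cos φ) / sin φ with hβd
    have hβ : β * sin φ = r * (1 + cos φ) := by rw [hβd]; field_simp
    set a := (d : ℝ) * φ with ha
    have e0 : a + φ = 2 * π - a := by rw [← hφ', ha]; ring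
    have ec : cos a * cos φ - sin a * sin φ = cos a := by
      rw [← cos_add, e0, cos_two_pi_sub]
    have es : sin a * cos φ + cos a * sin φ = -sin a := by
      rw [← sin_add, e0, sin_two_pi_sub]
    have hba : β * sin a = -(r * cos a) := by
      apply mul_left_cancel₀ hsin
      linear_combination sin a * hβ + r * es
    have hx := main φ hsin β hβ (by
      have e1 : ((d - 1 : ℕ) : ℝ) * φ = a - φ := by rw [ha, hdpred]; ring
      rw [e1, ← ha, cos_sub, sin_sub]
      linear_combination -q * ec - q * β * es + (q + q ^ 2) * hba - q * cos a * hrq)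
    have hsum := sum_sq_cos_add_sin φ β d
    rw [hφ', sin_two_pi, cos_two_pi, Finset.sum_Ico_succ_top (by omega)] at hsum
    rw [← Finset.mul_sum] at hx
    set A := ∑ i ∈ Finset.Ico 1 d, (cos (i * φ) + β * sin (i * φ)) ^ 2
    set z := (cos (d * φ) + β * sin (d * φ)) ^ 2
    have hβc : β * (1 - cos φ) = r * sin φ := by
      apply mul_left_cancel₀ hsin
      linear_combination (1 - cos φ) * hβ - r * sin_sq_add_cos_sq φ
    have hAz : 4 * (A + z) = 2 * d * (1 + β ^ 2) - (1 - β ^ 2) - 2 * r := by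
      apply mul_left_cancel₀ hsin
      linear_combination hsum - 2 * hβc
    have hβ2 : β ^ 2 = (4 * (((1 + (q + 1) / q * A + (q + 1) / (q * 1) * z) - 1) * q / (q + 1))
        + 1 + 2 * r - 2 * d) / (2 * d + 1) := by
      have e : ((1 + (q + 1) / q * A + (q + 1) / (q * 1) * z) - 1) * q / (q + 1) = A + z := by
        field_simp
        ring
      rw [e, eq_div_iff (by positivity)]
      linear_combination -hAz
    -- The denominator is odd, so the fraction is reduced, and it is at least 5.
    refine hirr (s := 2 / (2 * d + 1 : ℕ)) ?_ ?_ (cos_mem_of_sq_mem F hrF hr0 hsin hβ ?_)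
    · have : (2 / (2 * d + 1 : ℕ) : ℚ).den = 2 * d + 1 := by
        have := Rat.den_div_eq_of_coprime (a := 2) (b := (2 * d + 1 : ℕ)) (by positivity)
          (by simp)
        rw [Int.cast_natCast, Int.cast_ofNat] at this
        exact Int.ofNat_inj.1 this
      rw [this]; omega
    · rw [hφ]; push_cast; ring
    · rw [hβ2]
      have h4F : (4 : ℝ) ∈ F := by exact_mod_cast natCast_mem F 4
      exact div_mem (sub_mem (add_mem (add_mem (mul_mem h4F (div_mem (mul_mem
        (sub_mem hx (one_mem F)) hqF) (add_mem hqF (one_mem F)))) (one_mem F)) (mul_mem h2F hrF))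
        (mul_mem h2F hdF)) (add_mem (mul_mem h2F hdF) (one_mem F))
  · refine ⟨rfl, ?_⟩
    by_contra hcon
    -- Here the sine vanishes at distance `d`, and the boundary equation reduces to the equation
    -- defining `β`.
    set φ : ℝ := π / d with hφ
    have hφ' : d * φ = π := by rw [hφ]; field_simp
    have hφpos : 0 < φ := by positivity
    have hφlt : φ < π := by
      rw [hφ, div_lt_iff₀ (by positivity)]
      nlinarith [pi_pos]
    have hsin : sin φ ≠ 0 := (sin_pos_of_pos_of_lt_pi hφpos hφlt).ne'
    set β := r * (1 + cos φ) / sin φ with hβd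
    have hβ : β * sin φ = r * (1 + cos φ) := by rw [hβd]; field_simp
    have hx := main φ hsin β hβ (by
      have e1 : ((d - 1 : ℕ) : ℝ) * φ = π - φ := by rw [hdpred, ← hφ']; ring
      rw [e1, hφ', cos_pi_sub, sin_pi_sub, cos_pi, sin_pi]
      linear_combination (q + 1) * q * hβ + q * (1 + cos φ) * hrq)
    have hsum := sum_sq_cos_add_sin φ β (d - 1)
    have e2 : (2 * ((d - 1 : ℕ) : ℝ) + 1) * φ = 2 * π - φ := by rw [hdpred, ← hφ']; ring
    rw [e2, sin_two_pi_sub, cos_two_pi_sub, Nat.sub_add_cancel (by omega), hdpred] at hsum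
    rw [← Finset.mul_sum, hφ', cos_pi, sin_pi] at hx
    set A := ∑ i ∈ Finset.Ico 1 d, (cos (i * φ) + β * sin (i * φ)) ^ 2
    have hA : 2 * A = d * (1 + β ^ 2) - 2 := by
      apply mul_left_cancel₀ hsin
      linear_combination hsum / 2
    have hβ2 : β ^ 2 = 2 * (1 + (q + 1) / q * A + (q + 1) / (q * (q + 1)) * (-1 + β * 0) ^ 2)
        * q / (q + 1) / d - 1 := by
      field_simp
      linear_combination -(q + 1) * hA
    refine hirr (s := 1 / d) ?_ ?_ (cos_mem_of_sq_mem F hrF hr0 hsin hβ ?_)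
    · have : (1 / (d : ℕ) : ℚ).den = d := by
        have := Rat.den_div_eq_of_coprime (a := 1) (b := d) (by positivity) (by simp)
        rw [Int.cast_natCast, Int.cast_one] at this
        exact Int.ofNat_inj.1 this
      rw [this]; omega
    · rw [hφ]; push_cast; ring
    · rw [hβ2]
      exact sub_mem (div_mem (div_mem (mul_mem (mul_mem h2F hx) hqF) (add_mem hqF (one_mem F)))
        hdF) (one_mem F)

end FeitHigmanTrig

/-- Distances in a connected graph can be shortened by one step at either end. -/
theorem SimpleGraph.Connected.exists_dist_eq_one {X : Type*} {Γ : SimpleGraph X}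
    (h : Γ.Connected) {x y : X} {n : ℕ} (hxy : Γ.dist x y = n + 1) :
    ∃ z, Γ.dist x z = 1 ∧ Γ.dist z y = n := by
  obtain ⟨p, hp⟩ := h.exists_walk_length_eq_dist x y
  cases p with
  | nil => simp at hxy
  | @cons _ z _ hadj p =>
    have h1 : Γ.dist x z = 1 := SimpleGraph.dist_eq_one_iff_adj.2 hadj
    refine ⟨z, h1, ?_⟩
    have h2 := SimpleGraph.dist_le p
    have h3 := h.dist_triangle (u := x) (v := z) (w := y)
    simp only [SimpleGraph.Walk.length_cons] at hp
    omega

theorem SimpleGraph.Connected.exists_dist_eq {X : Type*} {Γ : SimpleGraph X}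
    (h : Γ.Connected) {x y : X} {k n : ℕ} (hk : k ≤ n) (hxy : Γ.dist x y = n) :
    ∃ z, Γ.dist z y = k := by
  induction n generalizing x with
  | zero => exact ⟨x, by omega⟩
  | succ n ih =>
    rcases hk.eq_or_lt with rfl | hlt
    · exact ⟨x, hxy⟩
    · obtain ⟨z, _, hz⟩ := h.exists_dist_eq_one hxy
      exact ih (by omega) hz

/-! ### The exponential equation relating the dimensions. -/

section Arithmetic

/-- If both exponents on the left were at least 2, the left side would be 1 and the right side `1 -
q` modulo `q ^ 2`. -/
theorem exponents_of_mul_eq_mul {q b f a : ℕ} (hq : 2 ≤ q) (hb : 1 ≤ b) (hf : 1 ≤ f) (ha : 2 ≤ a)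
    (h : ((q : ℤ) ^ b - 1) * (q ^ f - 1) = (q ^ a - 1) * (q - 1)) :
    (f = 1 ∧ b = a) ∨ (f = a ∧ b = 1) := by
  have hq1 : (q : ℤ) - 1 ≠ 0 := by
    have : (2 : ℤ) ≤ q := by exact_mod_cast hq
    omega
  have hinj : ∀ i j : ℕ, (q : ℤ) ^ i - 1 = q ^ j - 1 → i = j := by
    intro i j hij
    have : q ^ i = q ^ j := by exact_mod_cast sub_left_injective hij
    exact Nat.pow_right_injective hq this
  by_cases hf1 : f = 1
  · subst hf1
    left
    refine ⟨rfl, hinj _ _ (mul_right_cancel₀ hq1 ?_)⟩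
    simpa using h
  by_cases hb1 : b = 1
  · subst hb1
    right
    refine ⟨hinj _ _ (mul_right_cancel₀ hq1 ?_), rfl⟩
    rw [← h]; ring
  exfalso
  obtain ⟨b, rfl⟩ : ∃ b', b = b' + 2 := ⟨b - 2, by omega⟩
  obtain ⟨f, rfl⟩ : ∃ b', f = b' + 2 := ⟨f - 2, by omega⟩
  obtain ⟨a, rfl⟩ : ∃ b', a = b' + 2 := ⟨a - 2, by omega⟩
  have hq0 : (q : ℤ) ≠ 0 := by positivity
  have h1 : (q : ℤ) * (1 - q * (q ^ (a + 1) - q ^ a + q ^ b + q ^ f - q ^ (b + f + 2))) = 0 := by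
    linear_combination h
  have h2 := (mul_eq_zero.1 h1).resolve_left hq0
  have h3 : (q : ℤ) ∣ 1 := ⟨_, sub_eq_zero.1 h2⟩
  have h4 := Int.le_of_dvd one_pos h3
  omega

/-- The solutions of the equation relating the dimensions of a ball of radius one, of the meets of
two such balls, and of a ball of radius two. -/
theorem dimensions_of_count {q e m f h : ℕ} (hq : 2 ≤ q) (hm : 2 ≤ m) (hme : m < e) (hf : 1 ≤ f)
    (heh : e < h)
    (heq : ((q : ℤ) ^ h - q ^ e) * (q ^ f - 1) = (q ^ e - q) * (q ^ e - q ^ m)) :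
    m + 1 = e ∧ ((f = 1 ∧ h + 1 = 2 * e) ∨ (f + 1 = e ∧ h = e + 1)) := by
  obtain ⟨b, rfl⟩ : ∃ b, h = e + (b + 1) := ⟨h - e - 1, by omega⟩
  obtain ⟨a, rfl⟩ : ∃ a, e = m + (a + 1) := ⟨e - m - 1, by omega⟩
  obtain ⟨f, rfl⟩ : ∃ b, f = b + 1 := ⟨f - 1, by omega⟩
  have hq0 : (q : ℤ) ≠ 0 := by positivity
  have h1 : (q : ℤ) ^ a * ((q ^ (b + 1) - 1) * (q ^ (f + 1) - 1)) =
      (q ^ (m + a) - 1) * (q ^ (a + 1) - 1) := by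
    apply mul_left_cancel₀ (pow_ne_zero (m + 1) hq0)
    linear_combination heq
  -- The right side of `h1` is prime to `q`, so the factor `q ^ a` on the left is trivial.
  have ha : a = 0 := by
    by_contra hne
    obtain ⟨a, rfl⟩ : ∃ b, a = b + 1 := ⟨a - 1, by omega⟩
    have h3 : (q : ℤ) ∣ 1 := by
      refine ⟨q ^ a * ((q ^ (b + 1) - 1) * (q ^ (f + 1) - 1))
        - q ^ (m + a) * (q ^ (a + 2) - 1) + q ^ (a + 1), ?_⟩
      linear_combination -h1
    have h4 := Int.le_of_dvd one_pos h3
    omega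
  subst ha
  refine ⟨rfl, ?_⟩
  rcases exponents_of_mul_eq_mul (b := b + 1) (f := f + 1) (a := m) hq (by omega) (by omega) hm (by simpa using h1) with h | h
  · left; omega
  · right; omega

end Arithmetic

namespace PointLineGeometry

variable {P : Type*} {G : PointLineGeometry P}

theorem exists_line_of_dist_eq_one {x y : G.points} (hxy : G.pointGraph.dist x y = 1) :
    ∃ L ∈ G.lines, x.1 ∈ L ∧ y.1 ∈ L :=
  (SimpleGraph.dist_eq_one_iff_adj.1 hxy).2

theorem ne_of_dist_eq_one {x y : G.points} (hxy : G.pointGraph.dist x y = 1) : x.1 ≠ y.1 :=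
  fun he => by
    rw [Subtype.ext he, SimpleGraph.dist_self] at hxy
    omega

theorem dist_le_one_of_mem_line {L : Set P} (hL : L ∈ G.lines) {x y : G.points} (hx : x.1 ∈ L)
    (hy : y.1 ∈ L) : G.pointGraph.dist x y ≤ 1 := by
  by_cases hxy : x = y
  · rw [hxy, SimpleGraph.dist_self]; omega
  · have hadj : G.pointGraph.Adj x y := ⟨hxy, L, hL, hx, hy⟩
    exact (SimpleGraph.dist_eq_one_iff_adj.2 hadj).le

end PointLineGeometry

/-! ### Embedded geometries whose unit balls are subspaces. -/

section Embedded

variable {K V : Type*} [Field K] [AddCommGroup V] [Module K V]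

/-- A geometry embedded in a projective space, with metrically regular point graph of diameter `d`,
such that the ball of radius one about `x` is the subspace `S x`, and the ball of radius `i` about
`x` consists of the points of the geometry in `U i x`. -/
structure IsBallEmbedded (G : PointLineGeometry (ℙ K V)) (d : ℕ) (S : G.points → Submodule K V)
    (U : ℕ → G.points → Submodule K V) : Prop where
  line : ∀ L ∈ G.lines, IsProjSubspaceOfDim 2 L
  regular : IsMetricallyRegular G.pointGraph
  two_le : 2 ≤ d
  dist_le : ∀ x y, G.pointGraph.dist x y ≤ d
  exists_dist : ∃ x y, G.pointGraph.dist x y = d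
  le_S : ∀ x (p : ℙ K V),
    p.submodule ≤ S x ↔ ∃ hp : p ∈ G.points, G.pointGraph.dist x ⟨p, hp⟩ ≤ 1
  le_U : ∀ i ≤ d, ∀ x y : G.points, y.1.submodule ≤ U i x ↔ G.pointGraph.dist x y ≤ i

namespace IsBallEmbedded

variable {G : PointLineGeometry (ℙ K V)} {d : ℕ} {S : G.points → Submodule K V}
  {U : ℕ → G.points → Submodule K V}

theorem mem_points (h : IsBallEmbedded G d S U) {x : G.points} {p : ℙ K V}
    (hp : p.submodule ≤ S x) : p ∈ G.points := ((h.le_S x p).1 hp).1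

theorem le_S_iff (h : IsBallEmbedded G d S U) (x y : G.points) :
    y.1.submodule ≤ S x ↔ G.pointGraph.dist x y ≤ 1 := by
  rw [h.le_S]
  exact ⟨fun ⟨_, h⟩ => h, fun h => ⟨y.2, h⟩⟩

theorem self_le_S (h : IsBallEmbedded G d S U) (x : G.points) : x.1.submodule ≤ S x := by
  rw [h.le_S_iff, SimpleGraph.dist_self]; omega

theorem le_S_symm (h : IsBallEmbedded G d S U) {x y : G.points} (hxy : y.1.submodule ≤ S x) :
    x.1.submodule ≤ S y := by
  rwa [h.le_S_iff, SimpleGraph.dist_comm, ← h.le_S_iff]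

theorem dist_eq_zero (h : IsBallEmbedded G d S U) {x y : G.points} :
    G.pointGraph.dist x y = 0 ↔ x = y := h.regular.connected.dist_eq_zero_iff

theorem dist_triangle (h : IsBallEmbedded G d S U) (x y z : G.points) :
    G.pointGraph.dist x z ≤ G.pointGraph.dist x y + G.pointGraph.dist y z :=
  h.regular.connected.dist_triangle

theorem dist_eq_one (h : IsBallEmbedded G d S U) {x y : G.points} (hne : x ≠ y)
    (hxy : y.1.submodule ≤ S x) : G.pointGraph.dist x y = 1 := by
  have h1 := (h.le_S_iff x y).1 hxy
  have h2 := h.regular.connected.pos_dist_of_ne hne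
  omega

/-- `U 1 y` is known only through the points of the geometry that it contains, but every point of `S
x` is one of those. -/
theorem inf_U_one (h : IsBallEmbedded G d S U) (x y : G.points) : S x ⊓ U 1 y = S x ⊓ S y := by
  apply pointsOf_injective
  ext p
  simp only [mem_pointsOf, le_inf_iff]
  refine and_congr_right fun hp => ?_
  have := h.le_U 1 (by have := h.two_le; omega) y ⟨p, h.mem_points hp⟩
  rw [this, ← h.le_S_iff]

/-- The line of the geometry through two collinear points is the line of the projective space
through them. -/
theorem line_eq [FiniteDimensional K V] (h : IsBallEmbedded G d S U) {L : Set (ℙ K V)}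
    (hL : L ∈ G.lines) {p r : ℙ K V} (hpr : p ≠ r) (hp : p ∈ L) (hr : r ∈ L) :
    L = pointsOf (p.submodule ⊔ r.submodule) := by
  obtain ⟨W, hW, rfl⟩ := h.line L hL
  rw [← eq_sup_of_finrank_two hW hpr hp hr]

theorem line_subset_S (h : IsBallEmbedded G d S U) {L : Set (ℙ K V)} (hL : L ∈ G.lines)
    {x : G.points} (hx : x.1 ∈ L) : L ⊆ pointsOf (S x) := fun p hp =>
  (h.le_S_iff x ⟨p, G.line_subset L hL hp⟩).2 (PointLineGeometry.dist_le_one_of_mem_line hL hx hp)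

theorem pointsOf_sup_mem_lines [FiniteDimensional K V] (h : IsBallEmbedded G d S U)
    {x y : G.points} (hxy : G.pointGraph.dist x y = 1) :
    pointsOf (x.1.submodule ⊔ y.1.submodule) ∈ G.lines := by
  obtain ⟨L, hL, hx, hy⟩ := PointLineGeometry.exists_line_of_dist_eq_one hxy
  rw [← h.line_eq hL (PointLineGeometry.ne_of_dist_eq_one hxy) hx hy]
  exact hL

theorem sup_le_S [FiniteDimensional K V] (h : IsBallEmbedded G d S U) {x y : G.points}
    (hxy : G.pointGraph.dist x y = 1) : x.1.submodule ⊔ y.1.submodule ≤ S x ⊓ S y :=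
  le_inf (sup_le (h.self_le_S x) ((h.le_S_iff x y).2 hxy.le))
    (sup_le (h.le_S_symm ((h.le_S_iff x y).2 hxy.le)) (h.self_le_S y))

theorem image_ball_inter (h : IsBallEmbedded G d S U) (x y : G.points) {j : ℕ} (hj : j ≤ d) :
    Subtype.val '' {z : G.points | G.pointGraph.dist x z ≤ 1 ∧ G.pointGraph.dist y z ≤ j}
      = pointsOf (S x ⊓ U j y) := by
  ext p
  simp only [Set.mem_image, Set.mem_ofPred_eq, mem_pointsOf, le_inf_iff]
  constructor
  · rintro ⟨z, ⟨h1, h2⟩, rfl⟩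
    exact ⟨(h.le_S_iff x z).2 h1, (h.le_U j hj y z).2 h2⟩
  · rintro ⟨h1, h2⟩
    refine ⟨⟨p, h.mem_points h1⟩, ⟨(h.le_S_iff x _).1 h1, (h.le_U j hj y _).1 h2⟩, rfl⟩

theorem image_ball_one (h : IsBallEmbedded G d S U) (x : G.points) :
    Subtype.val '' {z : G.points | G.pointGraph.dist x z ≤ 1} = pointsOf (S x) := by
  ext p
  simp only [Set.mem_image, Set.mem_ofPred_eq, mem_pointsOf]
  constructor
  · rintro ⟨z, h1, rfl⟩
    exact (h.le_S_iff x z).2 h1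
  · intro h1
    exact ⟨⟨p, h.mem_points h1⟩, (h.le_S_iff x _).1 h1, rfl⟩

variable [Finite K]

theorem ncard_ball_inter (h : IsBallEmbedded G d S U) (x y : G.points) {j : ℕ} (hj : j ≤ d) :
    {z : G.points | G.pointGraph.dist x z ≤ 1 ∧ G.pointGraph.dist y z ≤ j}.ncard =
      ∑ i ∈ Finset.range (Module.finrank K ↥(S x ⊓ U j y)), Nat.card K ^ i := by
  rw [← ncard_pointsOf, ← h.image_ball_inter x y hj,
    Set.ncard_image_of_injective _ Subtype.val_injective]

theorem ncard_ball_one (h : IsBallEmbedded G d S U) (x : G.points) :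
    {z : G.points | G.pointGraph.dist x z ≤ 1}.ncard =
      ∑ i ∈ Finset.range (Module.finrank K (S x)), Nat.card K ^ i := by
  rw [← ncard_pointsOf, ← h.image_ball_one x,
    Set.ncard_image_of_injective _ Subtype.val_injective]

theorem two_le_card : 2 ≤ Nat.card K := Finite.one_lt_card

theorem finrank_eq_of_geomSum_eq {a b : ℕ}
    (h : ∑ i ∈ Finset.range a, Nat.card K ^ i = ∑ i ∈ Finset.range b, Nat.card K ^ i) : a = b :=
  (geomSum_strictMono (two_le_card (K := K))).injective h

/-- The dimension of the meet of a ball of radius one with a ball of radius `i - 1` whose centre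
is at distance `i` depends only on `i`. -/
theorem finrank_inf_U_pred (h : IsBallEmbedded G d S U) {x y x' y' : G.points} {i : ℕ}
    (hxy : G.pointGraph.dist x y = i + 1) (hxy' : G.pointGraph.dist x' y' = i + 1) :
    Module.finrank K ↥(S x ⊓ U i y) = Module.finrank K ↥(S x' ⊓ U i y') := by
  have hi : i ≤ d := by have := h.dist_le x y; omega
  apply finrank_eq_of_geomSum_eq (K := K)
  rw [← h.ncard_ball_inter _ _ hi, ← h.ncard_ball_inter _ _ hi]
  have key : ∀ a b : G.points, G.pointGraph.dist a b = i + 1 →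
      {z : G.points | G.pointGraph.dist a z ≤ 1 ∧ G.pointGraph.dist b z ≤ i} =
      {z : G.points | G.pointGraph.dist a z = 1 ∧ G.pointGraph.dist b z = i} := by
    intro a b hab
    ext z
    have := h.dist_triangle a z b
    rw [G.pointGraph.dist_comm (u := z)] at this
    simp only [Set.mem_ofPred_eq]
    omega
  rw [key _ _ hxy, key _ _ hxy', Set.ncard_def, Set.ncard_def,
    h.regular.card_inter (i + 1) i (Or.inl rfl) x y x' y' hxy hxy']

variable [FiniteDimensional K V]

theorem ncard_ball_one_eq (h : IsBallEmbedded G d S U) (x : G.points) :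
    {z : G.points | G.pointGraph.dist x z ≤ 1}.ncard =
      {z : G.points | G.pointGraph.dist x z = 1}.ncard + 1 := by
  have : {z : G.points | G.pointGraph.dist x z ≤ 1} =
      insert x {z : G.points | G.pointGraph.dist x z = 1} := by
    ext z
    simp only [Set.mem_ofPred_eq, Set.mem_insert_iff, Nat.le_one_iff_eq_zero_or_eq_one,
      h.dist_eq_zero, eq_comm (a := x)]
  rw [this, Set.ncard_insert_of_notMem (by simp)]

theorem finrank_S_eq (h : IsBallEmbedded G d S U) (x x' : G.points) :
    Module.finrank K (S x) = Module.finrank K (S x') := by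
  apply finrank_eq_of_geomSum_eq (K := K)
  rw [← h.ncard_ball_one, ← h.ncard_ball_one, h.ncard_ball_one_eq, h.ncard_ball_one_eq]
  have := congrArg ENat.toNat (h.regular.card_sphere 1 x x')
  simp only [Set.ncard_def, this]

/-- The dimension of the meet of a ball of radius one with a ball of radius `i` whose centre
is at distance `i` depends only on `i`. -/
theorem finrank_inf_U_self (h : IsBallEmbedded G d S U) {x y x' y' : G.points} {i : ℕ}
    (hxy : G.pointGraph.dist x y = i) (hxy' : G.pointGraph.dist x' y' = i) :
    Module.finrank K ↥(S x ⊓ U i y) = Module.finrank K ↥(S x' ⊓ U i y') := by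
  have hi : i ≤ d := by have := h.dist_le x y; omega
  apply finrank_eq_of_geomSum_eq (K := K)
  rw [← h.ncard_ball_inter _ _ hi, ← h.ncard_ball_inter _ _ hi]
  -- The complement is counted: what is missing from the unit ball about `a` is the set of
  -- neighbours at distance `i + 1` from `b`, whose size regularity controls.
  have key : ∀ a b : G.points, G.pointGraph.dist a b = i →
      {z : G.points | G.pointGraph.dist a z ≤ 1 ∧ G.pointGraph.dist b z ≤ i}.ncard +
      {z : G.points | G.pointGraph.dist a z = 1 ∧ G.pointGraph.dist b z = i + 1}.ncard =
      ∑ i ∈ Finset.range (Module.finrank K (S a)), Nat.card K ^ i := by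
    intro a b hab
    rw [← h.ncard_ball_one, ← Set.ncard_union_eq]
    · congr 1
      ext z
      have := h.dist_triangle b a z
      rw [G.pointGraph.dist_comm (u := b) (v := a)] at this
      have h2 := h.dist_triangle a z b
      rw [G.pointGraph.dist_comm (u := z)] at h2
      have h3 := h.dist_eq_zero (x := a) (y := z)
      simp only [Set.mem_union, Set.mem_ofPred_eq]
      constructor
      · rintro (h | h) <;> omega
      · intro hz
        rcases Nat.lt_or_ge i (G.pointGraph.dist b z) with h4 | h4
        · right
          refine ⟨?_, by omega⟩
          by_contra hne
          have h5 : a = z := h3.1 (by omega)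
          rw [← h5, G.pointGraph.dist_comm] at h4
          omega
        · exact Or.inl ⟨hz, h4⟩
    · rw [Set.disjoint_left]
      rintro z ⟨_, h1⟩ ⟨_, h2⟩
      omega
  have k1 := key _ _ hxy
  have k2 := key _ _ hxy'
  have k3 := congrArg ENat.toNat
    (h.regular.card_inter i (i + 1) (Or.inr (Or.inr rfl)) x y x' y' hxy hxy')
  rw [← Set.ncard_def, ← Set.ncard_def] at k3
  rw [h.finrank_S_eq x x'] at k1
  omega

end IsBallEmbedded

end Embedded

/-! ### Edge counts between spheres and the two possible sets of dimensions. -/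

section EmbeddedDimensions

variable {K V : Type*} [Field K] [AddCommGroup V] [Module K V]

namespace IsBallEmbedded

variable {G : PointLineGeometry (ℙ K V)} {d : ℕ} {S : G.points → Submodule K V}
  {U : ℕ → G.points → Submodule K V}

theorem exists_dist_eq (h : IsBallEmbedded G d S U) {i : ℕ} (hi : i ≤ d) :
    ∃ x y, G.pointGraph.dist x y = i := by
  obtain ⟨x, y, hxy⟩ := h.exists_dist
  obtain ⟨z, hz⟩ := h.regular.connected.exists_dist_eq hi hxy
  exact ⟨z, y, hz⟩

theorem two_le_finrank_inf_S [FiniteDimensional K V] (h : IsBallEmbedded G d S U) {x y : G.points}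
    (hxy : G.pointGraph.dist x y = 1) : 2 ≤ Module.finrank K ↥(S x ⊓ S y) := by
  rw [← finrank_sup_points (PointLineGeometry.ne_of_dist_eq_one hxy)]
  exact Submodule.finrank_mono (h.sup_le_S hxy)

variable [Finite K]

theorem finrank_inf_S_of_dist_two (h : IsBallEmbedded G d S U) {x y x' y' : G.points}
    (hxy : G.pointGraph.dist x y = 2) (hxy' : G.pointGraph.dist x' y' = 2) :
    Module.finrank K ↥(S x ⊓ S y) = Module.finrank K ↥(S x' ⊓ S y') := by
  rw [← h.inf_U_one, ← h.inf_U_one, h.finrank_inf_U_pred hxy hxy']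

variable [FiniteDimensional K V]

theorem finrank_inf_S_of_dist_one (h : IsBallEmbedded G d S U) {x y x' y' : G.points}
    (hxy : G.pointGraph.dist x y = 1) (hxy' : G.pointGraph.dist x' y' = 1) :
    Module.finrank K ↥(S x ⊓ S y) = Module.finrank K ↥(S x' ⊓ S y') := by
  rw [← h.inf_U_one, ← h.inf_U_one, h.finrank_inf_U_self hxy hxy']

/-- If adjacent points had equal unit balls, then along a path `a`, `b`, `c` with ends at distance
two, `c` would lie in `S b = S a`. -/
theorem finrank_inf_S_lt (h : IsBallEmbedded G d S U) {x y : G.points}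
    (hxy : G.pointGraph.dist x y = 1) :
    Module.finrank K ↥(S x ⊓ S y) < Module.finrank K (S x) := by
  obtain ⟨a, c, hac⟩ := h.exists_dist_eq h.two_le
  obtain ⟨b, hab, hbc⟩ := h.regular.connected.exists_dist_eq_one hac
  rw [h.finrank_inf_S_of_dist_one hxy hab, h.finrank_S_eq x a]
  refine lt_of_le_of_ne (Submodule.finrank_mono inf_le_left) fun heq => ?_
  have h1 : S a ⊓ S b = S a := Submodule.eq_of_le_of_finrank_eq inf_le_left heq
  have h2 : S a ⊓ S b = S b :=
    Submodule.eq_of_le_of_finrank_eq inf_le_right (heq.trans (h.finrank_S_eq a b))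
  have h3 : c.1.submodule ≤ S b := (h.le_S_iff b c).2 hbc.le
  rw [← h2, h1, h.le_S_iff] at h3
  omega

/-- Counting the edges between two consecutive spheres about `x`. -/
theorem card_sphere_succ (h : IsBallEmbedded G d S U) {e β γ i : ℕ} (hi : i ≤ d) (x : G.points)
    (he : ∀ x, Module.finrank K (S x) = e)
    (hβ : ∀ y, G.pointGraph.dist x y = i → Module.finrank K ↥(S y ⊓ U i x) = β)
    (hγ : ∀ z, G.pointGraph.dist x z = i + 1 → Module.finrank K ↥(S z ⊓ U i x) = γ) :
    {z : G.points | G.pointGraph.dist x z = i}.ncard *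
      ((∑ j ∈ Finset.range e, Nat.card K ^ j) - ∑ j ∈ Finset.range β, Nat.card K ^ j) =
    {z : G.points | G.pointGraph.dist x z = i + 1}.ncard *
      ∑ j ∈ Finset.range γ, Nat.card K ^ j := by
  classical
  have : Fintype G.points := Fintype.ofFinite _
  let A : Finset G.points := Finset.univ.filter fun z => G.pointGraph.dist x z = i
  let B : Finset G.points := Finset.univ.filter fun z => G.pointGraph.dist x z = i + 1
  have hA : {z : G.points | G.pointGraph.dist x z = i}.ncard = A.card := by
    rw [← Set.ncard_coe_finset]; congr 1; ext z; simp [A]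
  have hB : {z : G.points | G.pointGraph.dist x z = i + 1}.ncard = B.card := by
    rw [← Set.ncard_coe_finset]; congr 1; ext z; simp [B]
  have key := Finset.sum_card_bipartiteAbove_eq_sum_card_bipartiteBelow (s := A) (t := B)
    (fun y z => G.pointGraph.dist y z ≤ 1)
  rw [hA, hB, ← smul_eq_mul, ← smul_eq_mul, ← Finset.sum_const, ← Finset.sum_const]
  refine Eq.trans (Finset.sum_congr rfl fun y hy => ?_)
    (key.trans (Finset.sum_congr rfl fun z hz => ?_))
  · have hxy : G.pointGraph.dist x y = i := by simpa [A] using hy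
    rw [← he y, ← hβ y hxy, ← h.ncard_ball_inter y x hi, ← h.ncard_ball_one,
      ← Set.ncard_coe_finset, ← Set.ncard_sdiff (fun z hz => hz.1)]
    congr 1
    ext z
    have h1 := h.dist_triangle x y z
    simp only [Finset.coe_bipartiteAbove, Set.mem_sdiff, Set.mem_ofPred_eq, B,
      Finset.mem_filter, Finset.mem_univ, true_and]
    omega
  · have hxz : G.pointGraph.dist x z = i + 1 := by simpa [B] using hz
    rw [← hγ z hxz, ← h.ncard_ball_inter z x hi, ← Set.ncard_coe_finset]
    congr 1
    ext y
    have h1 := h.dist_triangle x y z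
    rw [G.pointGraph.dist_comm (u := y)] at h1
    simp only [Set.mem_ofPred_eq, Finset.mem_coe, A,
      Finset.mem_filter, Finset.mem_univ, true_and, Finset.mem_bipartiteBelow,
      G.pointGraph.dist_comm (u := y)]
    omega

theorem ncard_ball_two_eq (h : IsBallEmbedded G d S U) (x : G.points) :
    {z : G.points | G.pointGraph.dist x z ≤ 2}.ncard =
      (∑ i ∈ Finset.range (Module.finrank K (S x)), Nat.card K ^ i) +
      {z : G.points | G.pointGraph.dist x z = 2}.ncard := by
  rw [← h.ncard_ball_one, ← Set.ncard_union_eq]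
  · congr 1
    ext z
    simp only [Set.mem_ofPred_eq, Set.mem_union]
    omega
  · rw [Set.disjoint_left]
    intro z h1 h2
    simp only [Set.mem_ofPred_eq] at h1 h2
    omega

/-- The two possibilities for the dimensions. -/
theorem dimensions (h : IsBallEmbedded G d S U)
    (hg : ∀ x, ∃ k : ℕ, {z : G.points | G.pointGraph.dist x z ≤ 2}.ncard =
      ∑ i ∈ Finset.range k, Nat.card K ^ i) :
    ∃ e, 3 ≤ e ∧ (∀ x, Module.finrank K (S x) = e) ∧
      (∀ x y, G.pointGraph.dist x y = 1 → Module.finrank K ↥(S x ⊓ S y) + 1 = e) ∧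
      (((∀ x y, G.pointGraph.dist x y = 2 → Module.finrank K ↥(S x ⊓ S y) = 1) ∧
        ∀ x, {z : G.points | G.pointGraph.dist x z ≤ 2}.ncard =
          ∑ i ∈ Finset.range (2 * e - 1), Nat.card K ^ i) ∨
      ((∀ x y, G.pointGraph.dist x y = 2 → Module.finrank K ↥(S x ⊓ S y) + 1 = e) ∧
        ∀ x, {z : G.points | G.pointGraph.dist x z ≤ 2}.ncard =
          ∑ i ∈ Finset.range (e + 1), Nat.card K ^ i)) := by
  obtain ⟨a, c, hac⟩ := h.exists_dist_eq h.two_le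
  obtain ⟨b, hab, hbc⟩ := h.regular.connected.exists_dist_eq_one hac
  set e := Module.finrank K (S a) with hedef
  set m := Module.finrank K ↥(S a ⊓ S b) with hmdef
  set f := Module.finrank K ↥(S a ⊓ S c) with hfdef
  have he : ∀ x, Module.finrank K (S x) = e := fun x => h.finrank_S_eq x a
  have hm : ∀ x y, G.pointGraph.dist x y = 1 → Module.finrank K ↥(S x ⊓ S y) = m :=
    fun x y hxy => h.finrank_inf_S_of_dist_one hxy hab
  have hf : ∀ x y, G.pointGraph.dist x y = 2 → Module.finrank K ↥(S x ⊓ S y) = f :=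
    fun x y hxy => h.finrank_inf_S_of_dist_two hxy hac
  have hm2 : 2 ≤ m := h.two_le_finrank_inf_S hab
  have hme : m < e := h.finrank_inf_S_lt hab
  have hf1 : 1 ≤ f := one_le_finrank (p := b.1)
    (le_inf ((h.le_S_iff a b).2 hab.le) (h.le_S_symm ((h.le_S_iff b c).2 hbc.le)))
  set q := Nat.card K with hq
  have hq2 : 2 ≤ q := two_le_card
  have hmono := geomSum_strictMono hq2
  -- The exponent `k` could vary with `x`, but `m`, `e` and `f` do not, and in each arithmetic
  -- solution they determine `k`. Since `e ≥ 3`, the two values of `f` are different.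
  have hall : ∀ x, ∃ k, {z : G.points | G.pointGraph.dist x z ≤ 2}.ncard =
      ∑ i ∈ Finset.range k, q ^ i ∧
      (m + 1 = e ∧ ((f = 1 ∧ k + 1 = 2 * e) ∨ (f + 1 = e ∧ k = e + 1))) := by
    intro x
    obtain ⟨k, hk⟩ := hg x
    refine ⟨k, hk, ?_⟩
    have h1 := h.ncard_ball_two_eq x
    have h2 := h.card_sphere_succ (i := 1) (by have := h.two_le; omega) x he
      (fun y hy => by rw [h.inf_U_one, hm y x (by rw [SimpleGraph.dist_comm, hy])])
      (fun z hz => by rw [h.inf_U_one, hf z x (by rw [SimpleGraph.dist_comm, hz])])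
    have h3 := h.ncard_ball_one_eq x
    rw [h.ncard_ball_one x] at h3
    rw [he x, ← hq] at h1 h3
    rw [hk] at h1
    rw [← hq] at h2
    have hle : ∑ i ∈ Finset.range m, q ^ i < ∑ i ∈ Finset.range e, q ^ i := hmono hme
    set N1 := {z : G.points | G.pointGraph.dist x z = 1}.ncard
    set N2 := {z : G.points | G.pointGraph.dist x z = 2}.ncard
    have hN1 : 0 < N1 := by
      have h4 : ∑ i ∈ Finset.range 2, q ^ i < ∑ i ∈ Finset.range e, q ^ i := hmono (by omega)
      simp [Finset.sum_range_succ] at h4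
      omega
    have hN2 : 0 < N2 := by
      by_contra hcon
      have : N2 = 0 := by omega
      rw [this, zero_mul] at h2
      rcases Nat.mul_eq_zero.1 h2 with h5 | h5 <;> omega
    have hek : e < k := by
      have : (fun k => ∑ i ∈ Finset.range k, q ^ i) e < (fun k => ∑ i ∈ Finset.range k, q ^ i) k := by
        simp only; omega
      exact hmono.lt_iff_lt.1 this
    apply dimensions_of_count hq2 hm2 hme hf1 hek
    have gs : ∀ j : ℕ, ((∑ i ∈ Finset.range j, q ^ i : ℕ) : ℤ) * (q - 1) = q ^ j - 1 := fun j => by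
      push_cast
      exact geom_sum_mul _ _
    zify [hle.le] at h1 h2 h3
    have ge := gs e
    have gm := gs m
    have gf := gs f
    have gk := gs k
    push_cast at ge gm gf gk
    set Se := ∑ i ∈ Finset.range e, (q : ℤ) ^ i
    set Sm := ∑ i ∈ Finset.range m, (q : ℤ) ^ i
    set Sf := ∑ i ∈ Finset.range f, (q : ℤ) ^ i
    set Sk := ∑ i ∈ Finset.range k, (q : ℤ) ^ i
    have e1 : (q : ℤ) ^ k - q ^ e = (Sk - Se) * (q - 1) := by linear_combination ge - gk
    have e2 : (q : ℤ) ^ e - q = (Se - 1) * (q - 1) := by linear_combination -ge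
    have e3 : (q : ℤ) ^ e - q ^ m = (Se - Sm) * (q - 1) := by linear_combination gm - ge
    rw [e1, e2, e3, ← gf, h1]
    linear_combination -(q - 1 : ℤ) ^ 2 * h2 - (q - 1 : ℤ) ^ 2 * (Se - Sm) * h3
  obtain ⟨k0, -, hme1, hcase⟩ := hall a
  refine ⟨e, by omega, he, fun x y hxy => by rw [hm x y hxy, hme1], ?_⟩
  rcases hcase with ⟨h1, -⟩ | ⟨h1, -⟩
  · left
    refine ⟨fun x y hxy => by rw [hf x y hxy, h1], fun x => ?_⟩
    obtain ⟨k, hk, -, h2 | h2⟩ := hall x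
    · rw [hk]; congr 2; omega
    · omega
  · right
    refine ⟨fun x y hxy => by rw [hf x y hxy, h1], fun x => ?_⟩
    obtain ⟨k, hk, -, h2 | h2⟩ := hall x
    · omega
    · rw [hk, h2.2]

end IsBallEmbedded

end EmbeddedDimensions

/-! ### The case in which unit balls with centres at distance two meet in a hyperplane. -/

section SymplecticCase

variable {K V : Type*} [Field K] [AddCommGroup V] [Module K V]

/-- A subspace is generated by its points outside a subspace not containing it. -/
theorem le_of_forall_point_not_le {A B C : Submodule K V} (hAB : ¬ A ≤ B)
    (h : ∀ p : ℙ K V, p.submodule ≤ A → ¬ p.submodule ≤ B → p.submodule ≤ C) : A ≤ C := by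
  have key : ∀ v ∈ A, v ∉ B → v ∈ C := by
    intro v hv hvB
    have h0 : v ≠ 0 := fun h0 => hvB (h0 ▸ zero_mem B)
    have := h (Projectivization.mk K v h0)
    simp only [Projectivization.submodule_mk, Submodule.span_singleton_le_iff_mem] at this
    exact this hv hvB
  obtain ⟨y, hyA, hyB⟩ := SetLike.not_le_iff_exists.1 hAB
  intro v hv
  by_cases hvB : v ∈ B
  · have h1 := key (v + y) (add_mem hv hyA) fun hm => hyB (by simpa using sub_mem hm hvB)
    simpa using sub_mem h1 (key y hyA hyB)
  · exact key v hv hvB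

namespace IsBallEmbedded

variable {G : PointLineGeometry (ℙ K V)} {d : ℕ} {S : G.points → Submodule K V}
  {U : ℕ → G.points → Submodule K V} [FiniteDimensional K V]

/-- On a geodesic of length three from `x` to `y` with second vertex `w`, the balls about `x` and
`y` cut hyperplanes out of `S w`. These share a point because `e ≥ 3`, so `x` and `y` have a common
neighbour. -/
theorem diameter_eq_two (h : IsBallEmbedded G d S U) {e : ℕ} (he3 : 3 ≤ e)
    (he : ∀ x, Module.finrank K (S x) = e)
    (hm : ∀ x y, G.pointGraph.dist x y = 1 → Module.finrank K ↥(S x ⊓ S y) + 1 = e)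
    (hf : ∀ x y, G.pointGraph.dist x y = 2 → Module.finrank K ↥(S x ⊓ S y) + 1 = e) : d = 2 := by
  by_contra hne
  obtain ⟨x, y, hxy⟩ := h.exists_dist_eq (i := 3) (by have := h.two_le; omega)
  obtain ⟨w, hxw, hwy⟩ := h.regular.connected.exists_dist_eq_one hxy
  have h1 := finrank_add_le_add_inf (inf_le_right : S x ⊓ S w ≤ S w)
    (inf_le_left : S w ⊓ S y ≤ S w)
  have h2 := hm _ _ hxw
  have h3 := hf _ _ hwy
  rw [he w] at h1
  obtain ⟨p, hp⟩ := exists_point_of_finrank_pos (K := K) (V := V)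
    (U := (S x ⊓ S w) ⊓ (S w ⊓ S y)) (by omega)
  have hpx : p.submodule ≤ S x := hp.trans (inf_le_left.trans inf_le_left)
  have hpy : p.submodule ≤ S y := hp.trans (inf_le_right.trans inf_le_right)
  have h4 := (h.le_S_iff x ⟨p, h.mem_points hpx⟩).1 hpx
  have h5 := (h.le_S_iff y ⟨p, h.mem_points hpx⟩).1 hpy
  have h6 := h.dist_triangle x ⟨p, h.mem_points hpx⟩ y
  rw [G.pointGraph.dist_comm] at h5
  omega

/-- In diameter two, if the meets of two balls are hyperplanes in both, then all points lie in the
span of a ball and one further point. -/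
theorem point_le_sup (h : IsBallEmbedded G 2 S U) {e : ℕ} (he3 : 3 ≤ e)
    (he : ∀ x, Module.finrank K (S x) = e)
    (hm : ∀ x y, x ≠ y → Module.finrank K ↥(S x ⊓ S y) + 1 = e)
    {x y : G.points} (hxy : ¬ y.1.submodule ≤ S x) (z : G.points) :
    z.1.submodule ≤ S x ⊔ y.1.submodule := by
  set T := S x ⊔ y.1.submodule with hT
  have hne : ∀ w : G.points, ¬ w.1.submodule ≤ S x → x ≠ w := by
    rintro w hw rfl
    exact hw (h.self_le_S x)
  -- Such an `S w` is spanned by `w` and its hyperplane inside `S x`.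
  have step : ∀ w : G.points, w.1.submodule ≤ T → ¬ w.1.submodule ≤ S x → S w ≤ T := by
    intro w hwT hwx
    have h1 := finrank_sup_point (S x ⊓ S w) w.1 fun hle => hwx (hle.trans inf_le_left)
    have h2 : (S x ⊓ S w) ⊔ w.1.submodule = S w := by
      refine Submodule.eq_of_le_of_finrank_eq (sup_le inf_le_right (h.self_le_S w)) ?_
      rw [h1, he w, hm x w (hne w hwx)]
    rw [← h2]
    exact sup_le (inf_le_left.trans le_sup_left) hwT
  have hyT : S y ≤ T := step y le_sup_right hxy
  by_contra hz
  have hzx : ¬ z.1.submodule ≤ S x := fun hle => hz (hle.trans le_sup_left)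
  have hzy : z ≠ y := by
    rintro rfl
    exact hz le_sup_right
  -- a neighbour of `z` inside the span lies in the ball about `x`
  have hnb : ∀ w : G.points, S w ≤ T → S w ⊓ S z ≤ S x := by
    intro w hwT
    rw [← pointsOf_subset_iff]
    intro p hp
    rw [mem_pointsOf, le_inf_iff] at hp
    by_contra hpx
    have hpm := h.mem_points hp.1
    exact hz ((h.le_S_symm (y := ⟨p, hpm⟩) hp.2).trans (step ⟨p, hpm⟩ (hp.1.trans hwT) hpx))
  have hxz := hm x z (hne z hzx)
  have hyz := hm y z hzy.symm
  -- Inclusion and equal dimension give equality. The same holds with any `w` in `S y` off `S x` in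
  -- place of `y`, so a point `p` of this meet is adjacent or equal to all those `w`. They span `S
  -- y`, hence `S y ≤ S p`, which is too large a meet.
  have hEq : S y ⊓ S z = S x ⊓ S z :=
    Submodule.eq_of_le_of_finrank_eq (le_inf (hnb y hyT) inf_le_right) (by omega)
  obtain ⟨p, hp⟩ := exists_point_of_finrank_pos (K := K) (U := S y ⊓ S z) (by omega)
  rw [le_inf_iff] at hp
  have hpx : p.submodule ≤ S x := (le_inf hp.1 hp.2 |>.trans (hnb y hyT))
  have hpm := h.mem_points hp.1
  have hpy : (⟨p, hpm⟩ : G.points) ≠ y := by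
    rintro rfl
    exact hxy hpx
  have hle : S y ≤ S ⟨p, hpm⟩ := by
    refine le_of_forall_point_not_le (B := S x) (fun hle => hxy ((h.self_le_S y).trans hle)) ?_
    intro w hwy hwx
    have hwm := h.mem_points hwy
    have hwT : S ⟨w, hwm⟩ ≤ T := step ⟨w, hwm⟩ (hwy.trans hyT) hwx
    have hwz : (⟨w, hwm⟩ : G.points) ≠ z := by
      rintro rfl
      exact hz (hwy.trans hyT)
    have h1 := hm _ z hwz
    have h2 : S ⟨w, hwm⟩ ⊓ S z = S x ⊓ S z :=
      Submodule.eq_of_le_of_finrank_eq (le_inf (hnb _ hwT) inf_le_right) (by omega)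
    have h3 : p.submodule ≤ S ⟨w, hwm⟩ :=
      ((le_inf hpx hp.2).trans h2.ge).trans inf_le_left
    exact h.le_S_symm (x := ⟨w, hwm⟩) (y := ⟨p, hpm⟩) h3
  have h4 := hm _ y hpy
  rw [inf_eq_right.2 hle, he y] at h4
  omega

/-- A ball and one further point span everything, which gives the dimension. In diameter two the
ball of radius two is the whole geometry, and it already has as many points as the projective space.
-/
theorem points_eq_univ_of_dist_two [Finite K] (h : IsBallEmbedded G 2 S U) {e : ℕ} (he3 : 3 ≤ e)
    (he : ∀ x, Module.finrank K (S x) = e)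
    (hm : ∀ x y, G.pointGraph.dist x y = 1 → Module.finrank K ↥(S x ⊓ S y) + 1 = e)
    (hf : ∀ x y, G.pointGraph.dist x y = 2 → Module.finrank K ↥(S x ⊓ S y) + 1 = e)
    (hcard : ∀ x, {z : G.points | G.pointGraph.dist x z ≤ 2}.ncard =
          ∑ i ∈ Finset.range (e + 1), Nat.card K ^ i)
    (hspan : (⨆ p ∈ G.points, p.submodule) = (⊤ : Submodule K V)) :
    Module.finrank K V = e + 1 ∧ G.points = Set.univ := by
  obtain ⟨x, y, hxy⟩ := h.exists_dist
  have hm' : ∀ a b, a ≠ b → Module.finrank K ↥(S a ⊓ S b) + 1 = e := by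
    intro a b hab
    have h1 := h.dist_le a b
    have h2 := h.regular.connected.pos_dist_of_ne hab
    rcases (by omega : G.pointGraph.dist a b = 1 ∨ G.pointGraph.dist a b = 2) with h3 | h3
    · exact hm a b h3
    · exact hf a b h3
  have hyx : ¬ y.1.submodule ≤ S x := by
    rw [h.le_S_iff]; omega
  have hT : S x ⊔ y.1.submodule = ⊤ := by
    rw [eq_top_iff, ← hspan]
    exact iSup₂_le fun p hp => h.point_le_sup he3 he hm' hyx ⟨p, hp⟩
  have hV : Module.finrank K V = e + 1 := by
    rw [← finrank_top, ← hT, finrank_sup_point _ _ hyx, he]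
  refine ⟨hV, Set.eq_of_subset_of_ncard_le (Set.subset_univ _) ?_⟩
  have h1 : {z : G.points | G.pointGraph.dist x z ≤ 2} = Set.univ := by
    ext z; simp [h.dist_le x z]
  have h2 := hcard x
  rw [h1, Set.ncard_univ, Nat.card_coe_set_eq] at h2
  rw [h2, Set.ncard_univ, Projectivization.card_of_finrank K V hV]

end IsBallEmbedded

end SymplecticCase

/-! ### The case of a unique common neighbour: planes as unit balls, and diameter three. -/

section HexagonDimensions

variable {K V : Type*} [Field K] [AddCommGroup V] [Module K V]

namespace IsBallEmbedded

variable {G : PointLineGeometry (ℙ K V)} {d : ℕ} {S : G.points → Submodule K V}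
  {U : ℕ → G.points → Submodule K V}

theorem inf_U_pred_sup_le (h : IsBallEmbedded G d S U) {x y : G.points} {i : ℕ}
    (hxy : G.pointGraph.dist x y = i + 1) :
    (S x ⊓ U i y) ⊔ x.1.submodule ≤ S x ⊓ U (i + 1) y := by
  have hi := h.dist_le x y
  refine sup_le (pointsOf_subset_iff.1 fun p hp => ?_)
    (le_inf (h.self_le_S x) ((h.le_U _ (by omega) y x).2 (by rw [SimpleGraph.dist_comm, hxy])))
  rw [mem_pointsOf, le_inf_iff] at hp ⊢
  refine ⟨hp.1, ?_⟩
  have hpm := h.mem_points hp.1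
  have := (h.le_U i (by omega) y ⟨p, hpm⟩).1 hp.2
  exact (h.le_U (i + 1) (by omega) y ⟨p, hpm⟩).2 (by omega)

variable [FiniteDimensional K V]

/-- On a path `x`, `w`, `y`, two hyperplanes of `S w` meet in dimension at least `e - 2`, inside the
one-dimensional `S x ⊓ S y`. -/
theorem finrank_S_le_three (h : IsBallEmbedded G d S U) {e : ℕ}
    (he : ∀ x, Module.finrank K (S x) = e)
    (hm : ∀ x y, G.pointGraph.dist x y = 1 → Module.finrank K ↥(S x ⊓ S y) + 1 = e)
    (hf : ∀ x y, G.pointGraph.dist x y = 2 → Module.finrank K ↥(S x ⊓ S y) = 1) : e ≤ 3 := by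
  obtain ⟨x, y, hxy⟩ := h.exists_dist_eq h.two_le
  obtain ⟨w, hxw, hwy⟩ := h.regular.connected.exists_dist_eq_one hxy
  have h1 := finrank_add_le_add_inf (inf_le_right : S x ⊓ S w ≤ S w)
    (inf_le_left : S w ⊓ S y ≤ S w)
  have h2 := hm _ _ hxw
  have h3 := hm _ _ hwy
  have h4 := hf _ _ hxy
  have h5 : (S x ⊓ S w) ⊓ (S w ⊓ S y) ≤ S x ⊓ S y :=
    inf_le_inf inf_le_left inf_le_right
  have h6 := Submodule.finrank_mono h5
  rw [he w] at h1
  omega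

theorem one_le_finrank_inf_U_pred (h : IsBallEmbedded G d S U) {x y : G.points} {i : ℕ}
    (hxy : G.pointGraph.dist x y = i + 1) : 1 ≤ Module.finrank K ↥(S x ⊓ U i y) := by
  obtain ⟨w, hxw, hwy⟩ := h.regular.connected.exists_dist_eq_one hxy
  have hi := h.dist_le x y
  refine one_le_finrank (p := w.1) (le_inf ((h.le_S_iff x w).2 hxw.le)
    ((h.le_U i (by omega) y w).2 ?_))
  rw [SimpleGraph.dist_comm, hwy]

theorem finrank_inf_U_pred_lt (h : IsBallEmbedded G d S U) {x y : G.points} {i : ℕ}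
    (hxy : G.pointGraph.dist x y = i + 1) :
    Module.finrank K ↥(S x ⊓ U i y) + 1 ≤ Module.finrank K ↥(S x ⊓ U (i + 1) y) := by
  have hi := h.dist_le x y
  rw [← finrank_sup_point (S x ⊓ U i y) x.1 fun hle => ?_]
  · exact Submodule.finrank_mono (h.inf_U_pred_sup_le hxy)
  · have := (h.le_U i (by omega) y x).1 (hle.trans inf_le_right)
    rw [SimpleGraph.dist_comm] at this
    omega

variable [Finite K]

/-- Below the diameter some point at distance `i` has a neighbour at distance `i + 1`; regularity
transfers the resulting strict inequality to every pair. -/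
theorem finrank_inf_U_self_lt (h : IsBallEmbedded G d S U) {x y : G.points} {i : ℕ}
    (hxy : G.pointGraph.dist x y = i) (hi : i < d) :
    Module.finrank K ↥(S x ⊓ U i y) < Module.finrank K (S x) := by
  obtain ⟨a, c, hac⟩ := h.exists_dist_eq (i := i + 1) (by omega)
  obtain ⟨b, hab, hbc⟩ := h.regular.connected.exists_dist_eq_one hac
  rw [h.finrank_inf_U_self hxy hbc, h.finrank_S_eq x b]
  refine lt_of_le_of_ne (Submodule.finrank_mono inf_le_left) fun heq => ?_
  have h1 : S b ⊓ U i c = S b := Submodule.eq_of_le_of_finrank_eq inf_le_left heq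
  have h2 : a.1.submodule ≤ S b := (h.le_S_iff b a).2 (by rw [SimpleGraph.dist_comm, hab])
  rw [← h1, le_inf_iff, h.le_U i hi.le, SimpleGraph.dist_comm] at h2
  omega

/-- Sums over the neighbours of `x` of functions of the distance to `y`. -/
theorem sum_neighbors [Fintype G.points] (h : IsBallEmbedded G d S U) (g : ℕ → ℝ)
    {x y : G.points} {i : ℕ} (hxy : G.pointGraph.dist x y = i + 1) :
    ∑ z with G.pointGraph.dist x z = 1, g (G.pointGraph.dist y z) =
      (∑ j ∈ Finset.range (Module.finrank K ↥(S x ⊓ U i y)), (Nat.card K : ℝ) ^ j) * g i +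
      ((∑ j ∈ Finset.range (Module.finrank K ↥(S x ⊓ U (i + 1) y)), (Nat.card K : ℝ) ^ j) -
        (∑ j ∈ Finset.range (Module.finrank K ↥(S x ⊓ U i y)), (Nat.card K : ℝ) ^ j) - 1)
        * g (i + 1) +
      ((∑ j ∈ Finset.range (Module.finrank K (S x)), (Nat.card K : ℝ) ^ j) -
        ∑ j ∈ Finset.range (Module.finrank K ↥(S x ⊓ U (i + 1) y)), (Nat.card K : ℝ) ^ j)
        * g (i + 2) := by
  classical
  have hi := h.dist_le x y
  have hN : ∀ n, (∑ j ∈ Finset.range n, (Nat.card K : ℝ) ^ j) =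
      ((∑ j ∈ Finset.range n, Nat.card K ^ j : ℕ) : ℝ) := fun n => by push_cast; rfl
  rw [hN, hN, hN, ← h.ncard_ball_inter x y (by omega), ← h.ncard_ball_inter x y (by omega),
    ← h.ncard_ball_one x]
  let c : ℕ → ℕ := fun j =>
    (Finset.univ.filter fun z => G.pointGraph.dist x z = 1 ∧ G.pointGraph.dist y z = j).card
  have hcset : ∀ j, c j =
      {z : G.points | G.pointGraph.dist x z = 1 ∧ G.pointGraph.dist y z = j}.ncard := fun j => by
    simp only [c]; rw [← Set.ncard_coe_finset]; congr 1; ext z; simp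
  have htri : ∀ z, G.pointGraph.dist x z ≤ 1 →
      i ≤ G.pointGraph.dist y z ∧ G.pointGraph.dist y z ≤ i + 2 := by
    intro z hz
    have h1 := h.dist_triangle x z y
    have h2 := h.dist_triangle y x z
    rw [G.pointGraph.dist_comm (u := z)] at h1
    rw [G.pointGraph.dist_comm (u := y) (v := x)] at h2
    omega
  have hx0 : ∀ z, G.pointGraph.dist x z = 0 ↔ x = z := fun z => h.dist_eq_zero
  have hyx : G.pointGraph.dist y x = i + 1 := by rw [SimpleGraph.dist_comm, hxy]
  have hc0 : {z : G.points | G.pointGraph.dist x z ≤ 1 ∧ G.pointGraph.dist y z ≤ i}.ncard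
      = c i := by
    rw [hcset]
    congr 1
    ext z
    simp only [Set.mem_ofPred_eq]
    constructor
    · rintro ⟨h1, h2⟩
      have := htri z h1
      refine ⟨?_, by omega⟩
      by_contra hne
      have h3 := (hx0 z).1 (by omega)
      subst h3
      omega
    · omega
  have hc1 : {z : G.points | G.pointGraph.dist x z ≤ 1 ∧ G.pointGraph.dist y z ≤ i + 1}.ncard
      = c i + c (i + 1) + 1 := by
    rw [← hc0, hcset, ← Set.ncard_union_eq, ← Set.ncard_insert_of_notMem (a := x)]
    · congr 1
      ext z
      simp only [Set.mem_ofPred_eq,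
        Set.mem_insert_iff, Set.mem_union]
      constructor
      · rintro ⟨h1, h2⟩
        have h3 := hx0 z
        by_cases hxz : x = z
        · exact Or.inl hxz.symm
        · right
          have : G.pointGraph.dist x z = 1 := by
            have := mt h3.1 hxz
            omega
          omega
      · rintro (rfl | h1)
        · rw [SimpleGraph.dist_self]; omega
        · omega
    · simp only [Set.mem_ofPred_eq, Set.mem_union,
        SimpleGraph.dist_self]
      omega
    · rw [Set.disjoint_left]
      intro z h1 h2
      simp only [Set.mem_ofPred_eq] at h1 h2
      omega
  have hc2 : {z : G.points | G.pointGraph.dist x z ≤ 1}.ncard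
      = c i + c (i + 1) + 1 + c (i + 2) := by
    rw [← hc1, hcset, ← Set.ncard_union_eq]
    · congr 1
      ext z
      simp only [Set.mem_ofPred_eq, Set.mem_union]
      constructor
      · intro h1
        have h2 := htri z h1
        by_cases h4 : G.pointGraph.dist x z = 1
        · omega
        · have h3 := (hx0 z).1 (by omega)
          subst h3
          omega
      · omega
    · rw [Set.disjoint_left]
      intro z h1 h2
      simp only [Set.mem_ofPred_eq] at h1 h2
      omega
  rw [hc0, hc1, hc2]
  have hsum : ∑ z with G.pointGraph.dist x z = 1, g (G.pointGraph.dist y z) =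
      c i * g i + c (i + 1) * g (i + 1) + c (i + 2) * g (i + 2) := by
    have hcj : ∀ j, (c j : ℝ) * g j = ∑ z with G.pointGraph.dist x z = 1,
        if G.pointGraph.dist y z = j then g j else 0 := by
      intro j
      rw [← Finset.sum_filter, Finset.filter_filter, Finset.sum_const, nsmul_eq_mul]
    rw [hcj, hcj, hcj, ← Finset.sum_add_distrib, ← Finset.sum_add_distrib]
    refine Finset.sum_congr rfl fun z hz => ?_
    have h1 := htri z (by simpa using (Finset.mem_filter.1 hz).2.le)
    rcases (by omega : G.pointGraph.dist y z = i ∨ G.pointGraph.dist y z = i + 1 ∨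
      G.pointGraph.dist y z = i + 2) with h2 | h2 | h2 <;> simp [h2]
  rw [hsum]
  push_cast
  ring

/-- If two points at distance two have a unique common neighbour, the diameter is three and the
dimensions are those of a generalized hexagon of order `(q, q)`. -/
theorem hexagon_dimensions (h : IsBallEmbedded G d S U) {e : ℕ} (he3 : 3 ≤ e)
    (he : ∀ x, Module.finrank K (S x) = e)
    (hm : ∀ x y, G.pointGraph.dist x y = 1 → Module.finrank K ↥(S x ⊓ S y) + 1 = e)
    (hf : ∀ x y, G.pointGraph.dist x y = 2 → Module.finrank K ↥(S x ⊓ S y) = 1) :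
    d = 3 ∧ e = 3 ∧
      (∀ x y, G.pointGraph.dist x y = 2 → Module.finrank K ↥(S x ⊓ U 2 y) = 2) ∧
      ∀ x y, G.pointGraph.dist x y = 3 → Module.finrank K ↥(S x ⊓ U 2 y) = 2 := by
  classical
  have : Fintype G.points := Fintype.ofFinite _
  have he' : e = 3 := le_antisymm (h.finrank_S_le_three he hm hf) he3
  subst he'
  have hd2 := h.two_le
  obtain ⟨a, b, hab⟩ := h.exists_dist
  have : Nonempty G.points := ⟨a⟩
  set q := Nat.card K with hq
  have hq2 : 2 ≤ q := two_le_card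
  -- The two dimensions strictly increase between 1 and 3, exclusive at the top, so both are forced.
  have hinner : ∀ x y i, G.pointGraph.dist x y = i + 1 → i + 1 < d →
      Module.finrank K ↥(S x ⊓ U i y) = 1 ∧ Module.finrank K ↥(S x ⊓ U (i + 1) y) = 2 := by
    intro x y i hxy hi
    have h1 := h.one_le_finrank_inf_U_pred hxy
    have h2 := h.finrank_inf_U_pred_lt hxy
    have h3 := h.finrank_inf_U_self_lt hxy hi
    rw [he x] at h3
    omega
  obtain ⟨k, rfl⟩ : ∃ k, d = k + 1 := ⟨d - 1, by omega⟩
  have houter : ∀ x y, G.pointGraph.dist x y = k + 1 →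
      Module.finrank K ↥(S x ⊓ U k y) = Module.finrank K ↥(S a ⊓ U k b) ∧
      Module.finrank K ↥(S x ⊓ U (k + 1) y) = 3 := by
    intro x y hxy
    refine ⟨h.finrank_inf_U_pred hxy hab, ?_⟩
    have : S x ≤ U (k + 1) y := pointsOf_subset_iff.1 fun p hp =>
      (h.le_U (k + 1) le_rfl y ⟨p, h.mem_points hp⟩).2 (h.dist_le _ _)
    rw [inf_eq_left.2 this, he]
  set γ := Module.finrank K ↥(S a ⊓ U k b) with hγ
  have hγ1 : 1 ≤ γ := h.one_le_finrank_inf_U_pred hab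
  have hγ2 : γ ≤ 2 := by
    have := h.finrank_inf_U_pred_lt hab
    rw [(houter a b hab).2] at this
    omega
  -- The constant `c` is the number of neighbours one step nearer at maximal distance: it is 1 if `γ
  -- = 1`, the (2d+1)-gon pattern, and `q + 1` if `γ = 2`, the 2d-gon pattern.
  have hFH := feitHigman_of_order_eq G.pointGraph (q := q)
    (c := ∑ j ∈ Finset.range γ, (q : ℝ) ^ j) hd2 hq2 h.dist_le
    (by
      intro g x
      have h1 := h.ncard_ball_one_eq x
      rw [h.ncard_ball_one, he] at h1
      have h2 : ∑ z with G.pointGraph.dist x z = 1, g (G.pointGraph.dist x z) =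
          ∑ z with G.pointGraph.dist x z = 1, g 1 :=
        Finset.sum_congr rfl fun z hz => by rw [(Finset.mem_filter.1 hz).2]
      have h3 : {z : G.points | G.pointGraph.dist x z = 1}.ncard =
          (Finset.univ.filter fun z => G.pointGraph.dist x z = 1).card := by
        rw [← Set.ncard_coe_finset]; congr 1; ext z; simp
      rw [h2, Finset.sum_const, ← h3, nsmul_eq_mul]
      congr 1
      have h4 : ((∑ i ∈ Finset.range 3, Nat.card K ^ i : ℕ) : ℝ) = _ := congrArg Nat.cast h1
      push_cast [Finset.sum_range_succ] at h4
      rw [← hq] at h4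
      linear_combination -h4)
    (by
      intro g x y i hxy hi
      have h1 := hinner x y i hxy hi
      rw [h.sum_neighbors g hxy, h1.1, h1.2, he]
      simp only [Finset.sum_range_succ, Finset.sum_range_zero]
      ring)
    (by
      intro g x y hxy
      have h1 := houter x y hxy
      rw [h.sum_neighbors g hxy, h1.1, h1.2, he]
      simp only [Nat.add_sub_cancel]
      simp only [Finset.sum_range_succ (n := 2), Finset.sum_range_succ (n := 1),
        Finset.sum_range_succ (n := 0), Finset.sum_range_zero]
      ring)
    h.regular.connected
    (by
      rcases (by omega : γ = 1 ∨ γ = 2) with h1 | h1 <;> rw [h1]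
      · left; simp
      · right; simp [Finset.sum_range_succ, add_comm])
  have hγ' : γ = 2 := by
    rcases (by omega : γ = 1 ∨ γ = 2) with h1 | h1
    · have h2 := hFH.1
      rw [h1] at h2
      have : (q : ℝ) ≠ 0 := by positivity
      simp at h2
      omega
    · exact h1
  -- Diameter two would make `γ` the dimension of a meet of unit balls at distance two, which is 1.
  have hk : k = 2 := by
    have h1 := hFH.2
    by_contra hne
    have hk1 : k = 1 := by omega
    subst hk1
    have h2 := hf a b hab
    rw [← h.inf_U_one] at h2
    omega
  subst hk
  refine ⟨rfl, rfl, fun x y hxy => (hinner x y 1 hxy (by omega)).2, fun x y hxy => ?_⟩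
  rw [(houter x y hxy).1, hγ']

end IsBallEmbedded

end HexagonDimensions

/-! ### Uniqueness of shortest walks by induction on distance. -/

section UniqueGeodesics

variable {X : Type*} {Γ : SimpleGraph X}

/-- Any two shortest walks from `a` to `b` agree. -/
def SimpleGraph.UniqueGeodesic (Γ : SimpleGraph X) (a b : X) : Prop :=
  ∀ p p' : Γ.Walk a b, p.length = Γ.dist a b → p'.length = Γ.dist a b → p = p'

theorem SimpleGraph.UniqueGeodesic.symm {a b : X} (h : Γ.UniqueGeodesic a b) :
    Γ.UniqueGeodesic b a := by
  intro p p' hp hp'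
  have := h p.reverse p'.reverse (by rw [Walk.length_reverse, hp, dist_comm])
    (by rw [Walk.length_reverse, hp', dist_comm])
  rw [← p.reverse_reverse, this, p'.reverse_reverse]

theorem SimpleGraph.uniqueGeodesic_self (a : X) : Γ.UniqueGeodesic a a := by
  intro p p' hp hp'
  rw [dist_self] at hp hp'
  cases p with
  | nil =>
    cases p' with
    | nil => rfl
    | cons => simp at hp'
  | cons => simp at hp

/-- A single possible first step, with unique continuation, gives a single geodesic. -/
theorem SimpleGraph.Connected.uniqueGeodesic_of_gate (hc : Γ.Connected) {a b : X} {n : ℕ}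
    (hab : Γ.dist a b = n + 1)
    (hgate : ∀ c c', Γ.Adj a c → Γ.Adj a c' → Γ.dist c b = n → Γ.dist c' b = n → c = c')
    (hnext : ∀ c, Γ.dist c b = n → Γ.UniqueGeodesic c b) : Γ.UniqueGeodesic a b := by
  have hlen : ∀ {c} (_ : Γ.Adj a c) (p : Γ.Walk c b), p.length = n → Γ.dist c b = n := by
    intro c hac p hp
    have h1 := dist_le p
    have h2 := hc.dist_triangle (u := a) (v := c) (w := b)
    rw [dist_eq_one_iff_adj.2 hac] at h2
    omega
  intro p p' hp hp'
  rw [hab] at hp hp'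
  cases p with
  | nil => simp at hp
  | @cons _ c _ h p =>
    cases p' with
    | nil => simp at hp'
    | @cons _ c' _ h' p' =>
      simp only [Walk.length_cons, Nat.add_right_cancel_iff] at hp hp'
      have h1 := hlen h p hp
      have h2 := hlen h' p' hp'
      obtain rfl := hgate c c' h h' h1 h2
      rw [hnext c h1 p p' (by omega) (by omega)]

end UniqueGeodesics

/-! ### The incidence graph and the hexagon axioms. -/

namespace PointLineGeometry

variable {P : Type*} {G : PointLineGeometry P}

theorem exists_mem_line (L : G.lines) : ∃ x : G.points, x.1 ∈ L.1 := by
  have h1 := G.three_le_line L.1 L.2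
  have h2 : L.1.Nonempty := by
    rw [← Set.encard_pos]
    exact lt_of_lt_of_le (by decide) h1
  obtain ⟨x, hx⟩ := h2
  exact ⟨⟨x, G.line_subset _ L.2 hx⟩, hx⟩

theorem exists_incidence_walk {x y : G.points} (p : G.pointGraph.Walk x y) :
    ∃ w : G.incidenceGraph.Walk (Sum.inl x) (Sum.inl y), w.length = 2 * p.length := by
  induction p with
  | nil => exact ⟨SimpleGraph.Walk.nil, rfl⟩
  | @cons x z y hadj p ih =>
    obtain ⟨w, hw⟩ := ih
    obtain ⟨L, hL, hx, hz⟩ := hadj.2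
    have h1 : G.incidenceGraph.Adj (Sum.inl x) (Sum.inr ⟨L, hL⟩) := hx
    have h2 : G.incidenceGraph.Adj (Sum.inr ⟨L, hL⟩) (Sum.inl z) := hz
    refine ⟨SimpleGraph.Walk.cons h1 (SimpleGraph.Walk.cons h2 w), ?_⟩
    simp only [SimpleGraph.Walk.length_cons, hw]
    ring

theorem incidenceGraph_connected (hc : G.pointGraph.Connected) : G.incidenceGraph.Connected := by
  have h1 : ∀ x y : G.points, G.incidenceGraph.Reachable (Sum.inl x) (Sum.inl y) := by
    intro x y
    obtain ⟨p, -⟩ := hc.exists_walk_length_eq_dist x y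
    obtain ⟨w, -⟩ := exists_incidence_walk p
    exact ⟨w⟩
  have h2 : ∀ a, ∃ x : G.points, G.incidenceGraph.Reachable a (Sum.inl x) := by
    rintro (x | L)
    · exact ⟨x, SimpleGraph.Reachable.refl _⟩
    · obtain ⟨x, hx⟩ := exists_mem_line L
      have hadj : G.incidenceGraph.Adj (Sum.inr L) (Sum.inl x) := hx
      exact ⟨x, hadj.reachable⟩
  have : Nonempty (G.points ⊕ G.lines) := hc.nonempty.map Sum.inl
  refine ⟨fun a b => ?_⟩
  obtain ⟨x, hx⟩ := h2 a
  obtain ⟨y, hy⟩ := h2 b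
  exact (hx.trans (h1 x y)).trans hy.symm

/-- Passing from a point through a line to a point costs two incidences and at most one step of the
point graph. The end is fixed by an equation so that the induction can run over walks with arbitrary
ends. -/
theorem le_length_of_incidence_walk (hc : G.pointGraph.Connected) {a b : G.points ⊕ G.lines}
    (w : G.incidenceGraph.Walk a b) (y : G.points) (hb : b = Sum.inl y) :
    (∀ x, a = Sum.inl x → 2 * G.pointGraph.dist x y ≤ w.length) ∧
    ∀ L : G.lines, a = Sum.inr L → ∃ z : G.points, z.1 ∈ L.1 ∧
      2 * G.pointGraph.dist z y + 1 ≤ w.length := by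
  induction w with
  | nil =>
    subst hb
    refine ⟨fun x hx => ?_, fun L hL => by simp at hL⟩
    rw [Sum.inl.inj hx, SimpleGraph.dist_self]
    simp
  | @cons a c b hadj w ih =>
    obtain ⟨ih1, ih2⟩ := ih hb
    refine ⟨fun x hx => ?_, fun L hL => ?_⟩
    · subst hx
      rcases c with z | L
      · exact hadj.elim
      · obtain ⟨z, hz, hle⟩ := ih2 L rfl
        have h1 := dist_le_one_of_mem_line L.2 (x := x) (y := z) hadj hz
        have h2 := hc.dist_triangle (u := x) (v := z) (w := y)
        rw [SimpleGraph.Walk.length_cons]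
        omega
    · subst hL
      rcases c with z | M
      · refine ⟨z, hadj, ?_⟩
        have := ih1 z rfl
        rw [SimpleGraph.Walk.length_cons]
        omega
      · exact hadj.elim

theorem incidence_dist_points (hc : G.pointGraph.Connected) (x y : G.points) :
    G.incidenceGraph.dist (Sum.inl x) (Sum.inl y) = 2 * G.pointGraph.dist x y := by
  apply le_antisymm
  · obtain ⟨p, hp⟩ := hc.exists_walk_length_eq_dist x y
    obtain ⟨w, hw⟩ := exists_incidence_walk p
    rw [← hp, ← hw]
    exact SimpleGraph.dist_le w
  · obtain ⟨w, hw⟩ := (incidenceGraph_connected hc).exists_walk_length_eq_dist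
      (Sum.inl x) (Sum.inl y)
    rw [← hw]
    exact (le_length_of_incidence_walk hc w y rfl).1 x rfl

theorem incidence_dist_line_le (hc : G.pointGraph.Connected) {L : G.lines} {z : G.points}
    (hz : z.1 ∈ L.1) (b : G.points ⊕ G.lines) :
    G.incidenceGraph.dist (Sum.inr L) b ≤ G.incidenceGraph.dist (Sum.inl z) b + 1 := by
  have hadj : G.incidenceGraph.Adj (Sum.inr L) (Sum.inl z) := hz
  have := (incidenceGraph_connected hc).dist_triangle (u := Sum.inr L) (v := Sum.inl z) (w := b)
  rw [SimpleGraph.dist_eq_one_iff_adj.2 hadj] at this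
  omega

theorem exists_incidence_dist_line (hc : G.pointGraph.Connected) (L : G.lines) (y : G.points) :
    ∃ z : G.points, z.1 ∈ L.1 ∧
      G.incidenceGraph.dist (Sum.inr L) (Sum.inl y) = 2 * G.pointGraph.dist z y + 1 := by
  obtain ⟨w, hw⟩ := (incidenceGraph_connected hc).exists_walk_length_eq_dist
    (Sum.inr L) (Sum.inl y)
  obtain ⟨z, hz, hle⟩ := (le_length_of_incidence_walk hc w y rfl).2 L rfl
  refine ⟨z, hz, le_antisymm ?_ (hw ▸ hle)⟩
  rw [← incidence_dist_points hc]
  exact incidence_dist_line_le hc hz _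

/-- A near hexagon in which distance-two points have a unique common neighbour is a generalized
hexagon. -/
theorem isGeneralizedPolygon_six (hc : G.pointGraph.Connected)
    (hle : ∀ x y, G.pointGraph.dist x y ≤ 3) (hex : ∃ x y, G.pointGraph.dist x y = 3)
    (htri : ∀ L ∈ G.lines, ∀ x y z : G.points, x.1 ∉ L → y.1 ∈ L → z.1 ∈ L →
      G.pointGraph.dist x y = 1 → G.pointGraph.dist x z = 1 → y = z)
    (hquad : ∀ x y w w' : G.points, G.pointGraph.dist x y = 2 → G.pointGraph.dist x w = 1 →
      G.pointGraph.dist w y = 1 → G.pointGraph.dist x w' = 1 → G.pointGraph.dist w' y = 1 → w = w')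
    (hpent : ∀ L ∈ G.lines, ∀ x y z : G.points, y ≠ z → y.1 ∈ L → z.1 ∈ L →
      G.pointGraph.dist x y = 2 → G.pointGraph.dist x z = 2 →
      ∃ w : G.points, w.1 ∈ L ∧ G.pointGraph.dist x w ≤ 1)
    (hnear : ∀ L ∈ G.lines, ∀ x : G.points, ∃ y : G.points, y.1 ∈ L ∧ G.pointGraph.dist x y ≤ 2) :
    G.IsGeneralizedPolygon 6 := by
  have hI := incidenceGraph_connected hc
  have hmeet : ∀ {L M : G.lines} {z : G.points}, z.1 ∈ L.1 → z.1 ∈ M.1 →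
      G.incidenceGraph.dist (Sum.inr L) (Sum.inr M) ≤ 2 := by
    intro L M z hL hM
    have h1 := incidence_dist_line_le hc hL (Sum.inr M)
    have h2 := incidence_dist_line_le hc hM (Sum.inl z)
    rw [SimpleGraph.dist_self, SimpleGraph.dist_comm] at h2
    omega
  -- Two distinct points of `L` nearest to `y` would close a triangle or a pentagon; in the second
  -- case `hpent` gives a point of `L` nearer to `y`.
  have hlp : ∀ n, n + 1 < 6 → (∀ a b, G.incidenceGraph.dist a b = n →
      G.incidenceGraph.UniqueGeodesic a b) → ∀ (L : G.lines) (y : G.points),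
      G.incidenceGraph.dist (Sum.inr L) (Sum.inl y) = n + 1 →
      G.incidenceGraph.UniqueGeodesic (Sum.inr L) (Sum.inl y) := by
    intro n hn ih L y hd
    refine hI.uniqueGeodesic_of_gate hd ?_ fun c hcb => ih _ _ hcb
    have hmin : ∀ w : G.points, w.1 ∈ L.1 → n ≤ 2 * G.pointGraph.dist w y := by
      intro w hw
      have := incidence_dist_line_le hc hw (Sum.inl y)
      rw [incidence_dist_points hc] at this
      omega
    rintro (z | M) (z' | M') hz hz' hdz hdz'
    · rw [incidence_dist_points hc] at hdz hdz'
      by_contra hne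
      have hzz : z ≠ z' := fun h => hne (h ▸ rfl)
      rw [G.pointGraph.dist_comm] at hdz hdz'
      rcases (by omega : G.pointGraph.dist y z = 0 ∨ G.pointGraph.dist y z = 1 ∨
        G.pointGraph.dist y z = 2) with h | h | h
      · have h1 := hc.dist_eq_zero_iff.1 h
        have h2 := hc.dist_eq_zero_iff.1 (by omega : G.pointGraph.dist y z' = 0)
        exact hzz (h1.symm.trans h2)
      · refine hzz (htri L.1 L.2 y z z' (fun hy => ?_) hz hz' h (by omega))
        have := hmin y hy
        rw [SimpleGraph.dist_self] at this
        omega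
      · obtain ⟨w, hw, hwd⟩ := hpent L.1 L.2 y z z' hzz hz hz' h (by omega)
        have := hmin w hw
        rw [G.pointGraph.dist_comm] at this
        omega
    · exact hz'.elim
    · exact hz.elim
    · exact hz.elim
  have huniq : ∀ n, n < 6 → ∀ a b, G.incidenceGraph.dist a b = n →
      G.incidenceGraph.UniqueGeodesic a b := by
    intro n
    induction n with
    | zero =>
      intro _ a b hd
      obtain rfl := hI.dist_eq_zero_iff.1 hd
      exact SimpleGraph.uniqueGeodesic_self a
    | succ n ih =>
      intro hn a b hd
      have ih' := ih (by omega)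
      rcases a with x | L <;> rcases b with y | M
      · refine hI.uniqueGeodesic_of_gate hd ?_ fun c hcb => ih' _ _ hcb
        rw [incidence_dist_points hc] at hd
        rintro (z | M) (z' | M') hz hz' hdz hdz'
        · exact hz.elim
        · exact hz.elim
        · exact hz'.elim
        · obtain ⟨z, hzM, hz1⟩ := exists_incidence_dist_line hc M y
          obtain ⟨z', hzM', hz1'⟩ := exists_incidence_dist_line hc M' y
          have t1 := hc.dist_triangle (u := x) (v := z) (w := y)
          have t2 := hc.dist_triangle (u := x) (v := z') (w := y)
          have u1 := dist_le_one_of_mem_line M.2 (x := x) (y := z) hz hzM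
          have u2 := dist_le_one_of_mem_line M'.2 (x := x) (y := z') hz' hzM'
          have hzz : z = z' := by
            rcases (by omega : G.pointGraph.dist x y = 1 ∨ G.pointGraph.dist x y = 2) with h | h
            · have h1 := hc.dist_eq_zero_iff.1 (by omega : G.pointGraph.dist z y = 0)
              have h2 := hc.dist_eq_zero_iff.1 (by omega : G.pointGraph.dist z' y = 0)
              rw [h1, h2]
            · exact hquad x y z z' h (by omega) (by omega) (by omega) (by omega)
          subst hzz
          have hxz : x.1 ≠ z.1 := ne_of_dist_eq_one (by omega)
          have := G.line_unique M.1 M.2 M'.1 M'.2 x.1 z.1 hxz hz hzM hz' hzM'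
          rw [Subtype.ext this]
      · rw [SimpleGraph.dist_comm] at hd
        exact (hlp n hn ih' M x hd).symm
      · exact hlp n hn ih' L y hd
      · refine hI.uniqueGeodesic_of_gate hd ?_ fun c hcb => ih' _ _ hcb
        rintro (z | M₁) (z' | M₂) hz hz' hdz hdz'
        · replace hz : z.1 ∈ L.1 := hz
          replace hz' : z'.1 ∈ L.1 := hz'
          rw [SimpleGraph.dist_comm] at hdz hdz'
          obtain ⟨w, hw, hw1⟩ := exists_incidence_dist_line hc M z
          obtain ⟨w', hw', hw1'⟩ := exists_incidence_dist_line hc M z'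
          by_contra hne
          have hzz : z ≠ z' := fun h => hne (h ▸ rfl)
          -- A point-line distance is odd. Two different first steps give lines with two common
          -- points if `n = 1`, and a triangle or a quadrangle if `n = 3`.
          rcases (by omega : n = 1 ∨ n = 3) with rfl | rfl
          · have h1 := hc.dist_eq_zero_iff.1 (by omega : G.pointGraph.dist w z = 0)
            have h2 := hc.dist_eq_zero_iff.1 (by omega : G.pointGraph.dist w' z' = 0)
            subst h1 h2
            have := G.line_unique L.1 L.2 M.1 M.2 w.1 w'.1
              (fun h => hzz (Subtype.ext h)) hz hz' hw hw'
            rw [Subtype.ext this, SimpleGraph.dist_self] at hd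
            omega
          · have hdisj : ∀ v : G.points, v.1 ∈ L.1 → v.1 ∉ M.1 := by
              intro v hv hv'
              have := hmeet hv hv'
              omega
            have d1 : G.pointGraph.dist w z = 1 := by omega
            have d2 : G.pointGraph.dist w' z' = 1 := by omega
            have d3 := dist_le_one_of_mem_line L.2 hz hz'
            have d4 := dist_le_one_of_mem_line M.2 hw hw'
            have d5 := hc.pos_dist_of_ne hzz
            have hww : w ≠ w' := by
              rintro rfl
              exact hzz (htri L.1 L.2 w z z' (fun h => hdisj w h hw) hz hz' d1 d2)
            have d6 := hc.pos_dist_of_ne hww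
            have d7 := hc.dist_triangle (u := z) (v := z') (w := w')
            rw [G.pointGraph.dist_comm] at d1
            rw [G.pointGraph.dist_comm] at d2
            rcases (by omega : G.pointGraph.dist z w' = 0 ∨ G.pointGraph.dist z w' = 1 ∨
              G.pointGraph.dist z w' = 2) with h | h | h
            · have := hc.dist_eq_zero_iff.1 h
              exact hdisj z hz (this ▸ hw')
            · exact hww (htri M.1 M.2 z w w' (hdisj z hz) hw hw' d1 h)
            · have := hquad z w' z' w h (by omega) d2 d1 (by omega)
              exact hdisj z' hz' (this ▸ hw)
        · exact hz'.elim
        · exact hz.elim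
        · exact hz.elim
  have hcoe : ∀ a b, G.incidenceGraph.edist a b = (G.incidenceGraph.dist a b : ℕ∞) := fun a b =>
    ((hI a b).coe_dist_eq_edist).symm
  have hpl : ∀ (L : G.lines) (x : G.points),
      G.incidenceGraph.dist (Sum.inr L) (Sum.inl x) ≤ 5 := by
    intro L x
    obtain ⟨y, hy, hd⟩ := hnear L.1 L.2 x
    have := incidence_dist_line_le hc hy (Sum.inl x)
    rw [incidence_dist_points hc, G.pointGraph.dist_comm] at this
    omega
  refine ⟨by norm_num, fun a b hab => ?_, fun a b => ?_, ?_⟩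
  · rw [hcoe] at hab ⊢
    have hab' : G.incidenceGraph.dist a b < 6 := by exact_mod_cast hab
    obtain ⟨p, hp⟩ := hI.exists_walk_length_eq_dist a b
    refine ⟨p, by exact_mod_cast hp, fun p' hp' => ?_⟩
    exact huniq _ hab' a b rfl p' p (by exact_mod_cast hp') hp
  · rw [hcoe]
    have : G.incidenceGraph.dist a b ≤ 6 := by
      rcases a with x | L <;> rcases b with y | M
      · rw [incidence_dist_points hc]
        have := hle x y
        omega
      · rw [SimpleGraph.dist_comm]
        have := hpl M x
        omega
      · have := hpl L y
        omega
      · obtain ⟨x, hx⟩ := exists_mem_line L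
        have h1 := incidence_dist_line_le hc hx (Sum.inr M)
        have h2 := hpl M x
        rw [SimpleGraph.dist_comm] at h2
        omega
    exact_mod_cast this
  · obtain ⟨x, y, hxy⟩ := hex
    refine ⟨Sum.inl x, Sum.inl y, ?_⟩
    rw [hcoe, incidence_dist_points hc, hxy]

end PointLineGeometry

/-! ### The hexagon, its parameters and its number of points. -/

section Hexagon

variable {K V : Type*} [Field K] [AddCommGroup V] [Module K V]

namespace IsBallEmbedded

variable {G : PointLineGeometry (ℙ K V)} {S : G.points → Submodule K V}
  {U : ℕ → G.points → Submodule K V} [FiniteDimensional K V]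

/-- Triangles and pentagons are excluded because a two-dimensional meet containing two points of a
line is that line. Each line has a point within distance two of `x` because two lines of the plane
`S y` meet. -/
theorem isGeneralizedHexagon (h : IsBallEmbedded G 3 S U)
    (he : ∀ x, Module.finrank K (S x) = 3)
    (hm : ∀ x y, G.pointGraph.dist x y = 1 → Module.finrank K ↥(S x ⊓ S y) + 1 = 3)
    (hf : ∀ x y, G.pointGraph.dist x y = 2 → Module.finrank K ↥(S x ⊓ S y) = 1)
    (h2 : ∀ x y, G.pointGraph.dist x y = 2 → Module.finrank K ↥(S x ⊓ U 2 y) = 2)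
    (h3 : ∀ x y, G.pointGraph.dist x y = 3 → Module.finrank K ↥(S x ⊓ U 2 y) = 2) :
    G.IsGeneralizedPolygon 6 := by
  have hadj : ∀ L ∈ G.lines, ∀ y z : G.points, y ≠ z → y.1 ∈ L → z.1 ∈ L →
      G.pointGraph.dist y z = 1 := fun L hL y z hyz hy hz => by
    have h1 := PointLineGeometry.dist_le_one_of_mem_line hL hy hz
    have h2 := h.regular.connected.pos_dist_of_ne hyz
    omega
  refine PointLineGeometry.isGeneralizedPolygon_six h.regular.connected h.dist_le h.exists_dist
    ?_ ?_ ?_ ?_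
  · intro L hL x y z hx hy hz hxy hxz
    by_contra hyz
    have hne : y.1 ≠ z.1 := fun he => hyz (Subtype.ext he)
    have d1 := hadj L hL y z hyz hy hz
    have e1 := eq_sup_of_finrank_two (U := S y ⊓ S z) (by have := hm y z d1; omega) hne
      (le_sup_left.trans (h.sup_le_S d1)) (le_sup_right.trans (h.sup_le_S d1))
    refine hx ?_
    rw [h.line_eq hL hne hy hz, ← e1, mem_pointsOf]
    exact le_inf (h.le_S_symm ((h.le_S_iff x y).2 hxy.le))
      (h.le_S_symm ((h.le_S_iff x z).2 hxz.le))
  · intro x y w w' hxy hxw hwy hxw' hwy'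
    refine Subtype.ext (eq_of_finrank_one (hf x y hxy) ?_ ?_)
    · exact le_inf ((h.le_S_iff x w).2 hxw.le) (h.le_S_symm ((h.le_S_iff w y).2 hwy.le))
    · exact le_inf ((h.le_S_iff x w').2 hxw'.le) (h.le_S_symm ((h.le_S_iff w' y).2 hwy'.le))
  · intro L hL x y z hyz hy hz hxy hxz
    have hne : y.1 ≠ z.1 := fun he => hyz (Subtype.ext he)
    have hyx : G.pointGraph.dist y x = 2 := by rw [SimpleGraph.dist_comm, hxy]
    have e1 := eq_sup_of_finrank_two (U := S y ⊓ U 2 x) (h2 y x hyx) hne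
      (le_inf (h.self_le_S y) ((h.le_U 2 (by omega) x y).2 hxy.le))
      (le_inf ((h.le_S_iff y z).2 (hadj L hL y z hyz hy hz).le)
        ((h.le_U 2 (by omega) x z).2 hxz.le))
    obtain ⟨w, hyw, hwx⟩ := h.regular.connected.exists_dist_eq_one hyx
    rw [SimpleGraph.dist_comm] at hwx
    refine ⟨w, ?_, hwx.le⟩
    rw [h.line_eq hL hne hy hz, ← e1, mem_pointsOf]
    exact le_inf ((h.le_S_iff y w).2 hyw.le) ((h.le_U 2 (by omega) x w).2 (by omega))
  · intro L hL x
    obtain ⟨y, hy⟩ := PointLineGeometry.exists_mem_line ⟨L, hL⟩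
    rcases (h.dist_le x y).lt_or_eq with hlt | heq
    · exact ⟨y, hy, by omega⟩
    · have hle := h.line_subset_S hL hy
      obtain ⟨W, hW, rfl⟩ := h.line L hL
      rw [pointsOf_subset_iff] at hle
      have h4 := finrank_add_le_add_inf hle (inf_le_left : S y ⊓ U 2 x ≤ S y)
      rw [hW, he, h3 y x (by rw [SimpleGraph.dist_comm, heq])] at h4
      obtain ⟨p, hp⟩ := exists_point_of_finrank_pos (K := K) (U := W ⊓ (S y ⊓ U 2 x)) (by omega)
      rw [le_inf_iff, le_inf_iff] at hp
      exact ⟨⟨p, h.mem_points hp.2.1⟩, hp.1, (h.le_U 2 (by omega) x _).1 hp.2.2⟩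

variable [Finite K]

/-- The lines on `x` correspond to the points of a line `W` of the plane `S x` that misses `x`. -/
theorem hasParameters {d : ℕ} (h : IsBallEmbedded G d S U)
    (he : ∀ x, Module.finrank K (S x) = 3) :
    G.HasParameters (Nat.card K) (Nat.card K) := by
  have hline : ∀ W : Submodule K V, Module.finrank K W = 2 →
      (pointsOf W).encard = Nat.card K + 1 := by
    intro W hW
    rw [← (Set.toFinite (pointsOf W)).cast_ncard_eq, ncard_pointsOf, hW]
    simp [Finset.sum_range_succ, add_comm]
  refine ⟨fun L hL => ?_, fun x hx => ?_⟩
  · obtain ⟨W, hW, rfl⟩ := h.line L hL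
    exact hline W hW
  · obtain ⟨p, hp, hpx⟩ := exists_point_le_not_le (U := S ⟨x, hx⟩) (U' := x.submodule) fun hle => by
      have := Submodule.finrank_mono hle
      rw [he, x.finrank_submodule] at this
      omega
    have hxp : x ≠ p := by rintro rfl; exact hpx le_rfl
    obtain ⟨r, hr, hrx⟩ := exists_point_le_not_le (U := S ⟨x, hx⟩)
      (U' := x.submodule ⊔ p.submodule) fun hle => by
      have := Submodule.finrank_mono hle
      rw [he, finrank_sup_points hxp] at this
      omega
    have hpr : p ≠ r := by rintro rfl; exact hrx le_sup_right
    set W := p.submodule ⊔ r.submodule with hWdef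
    have hW : Module.finrank K W = 2 := finrank_sup_points hpr
    have hWS : W ≤ S ⟨x, hx⟩ := sup_le hp hr
    have hxW : ¬ x.submodule ≤ W := by
      intro hle
      have := eq_sup_of_finrank_two hW hxp hle le_sup_left
      exact hrx (this ▸ le_sup_right)
    have hxne : ∀ z : ℙ K V, z.submodule ≤ W → x ≠ z := by
      rintro z hz rfl
      exact hxW hz
    have himg : {L ∈ G.lines | x ∈ L} =
        (fun z : ℙ K V => pointsOf (x.submodule ⊔ z.submodule)) '' pointsOf W := by
      ext L
      constructor
      · rintro ⟨hL, hxL⟩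
        have hle := h.line_subset_S (x := ⟨x, hx⟩) hL hxL
        obtain ⟨M, hM, rfl⟩ := h.line L hL
        rw [pointsOf_subset_iff] at hle
        have h4 := finrank_add_le_add_inf hle hWS
        rw [hM, he, hW] at h4
        obtain ⟨z, hz⟩ := exists_point_of_finrank_pos (K := K) (U := M ⊓ W) (by omega)
        rw [le_inf_iff] at hz
        exact ⟨z, hz.2, by simp only [← eq_sup_of_finrank_two hM (hxne z hz.2) hxL hz.1]⟩
      · rintro ⟨z, hz, rfl⟩
        have hzS : z.submodule ≤ S ⟨x, hx⟩ := le_trans hz hWS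
        have hzm := h.mem_points hzS
        have hne : (⟨x, hx⟩ : G.points) ≠ ⟨z, hzm⟩ := fun he => hxne z hz (congrArg Subtype.val he)
        have hL := h.pointsOf_sup_mem_lines (x := ⟨x, hx⟩) (y := ⟨z, hzm⟩) (h.dist_eq_one hne hzS)
        exact ⟨hL, mem_pointsOf.2 le_sup_left⟩
    rw [himg, Set.InjOn.encard_image, hline W hW]
    intro z hz z' hz' heq
    by_contra hne
    have h1 := pointsOf_injective heq
    have h2 := eq_sup_of_finrank_two hW hne hz hz'
    have h3 : W ≤ x.submodule ⊔ z.submodule := by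
      rw [h2]
      exact sup_le le_sup_right (h1 ▸ le_sup_right)
    have h4 := Submodule.eq_of_le_of_finrank_eq h3 (by rw [hW, finrank_sup_points (hxne z hz)])
    exact hxW (h4 ▸ le_sup_left)

/-- The sphere of radius two has `q ^ 3 + q ^ 4` points. Each has `q ^ 2` neighbours at distance
three, and each point at distance three has `q + 1` neighbours at distance two, so the last sphere
has `q ^ 5` points. -/
theorem card_points (h : IsBallEmbedded G 3 S U)
    (he : ∀ x, Module.finrank K (S x) = 3)
    (h2 : ∀ x y, G.pointGraph.dist x y = 2 → Module.finrank K ↥(S x ⊓ U 2 y) = 2)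
    (h3 : ∀ x y, G.pointGraph.dist x y = 3 → Module.finrank K ↥(S x ⊓ U 2 y) = 2)
    (hcard : ∀ x, {z : G.points | G.pointGraph.dist x z ≤ 2}.ncard =
          ∑ i ∈ Finset.range 5, Nat.card K ^ i) :
    G.points.ncard = ∑ i ∈ Finset.range 6, Nat.card K ^ i := by
  obtain ⟨x, y, hxy⟩ := h.exists_dist
  have e1 := h.ncard_ball_two_eq x
  have e2 := h.card_sphere_succ (i := 2) (by omega) x he
    (fun y hy => h2 y x (by rw [SimpleGraph.dist_comm, hy]))
    (fun z hz => h3 z x (by rw [SimpleGraph.dist_comm, hz]))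
  have e3 : G.points.ncard = {z : G.points | G.pointGraph.dist x z ≤ 2}.ncard +
      {z : G.points | G.pointGraph.dist x z = 3}.ncard := by
    rw [← Nat.card_coe_set_eq, ← Set.ncard_univ, ← Set.ncard_union_eq]
    · congr 1
      ext z
      have := h.dist_le x z
      simp only [Set.mem_univ, Set.mem_union, Set.mem_ofPred_eq, true_iff]
      omega
    · rw [Set.disjoint_left]
      intro z h1 h2
      simp only [Set.mem_ofPred_eq] at h1 h2
      omega
  rw [hcard, he] at e1
  rw [hcard] at e3
  rw [e3]
  set q := Nat.card K
  set n₂ := {z : G.points | G.pointGraph.dist x z = 2}.ncard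
  set n₃ := {z : G.points | G.pointGraph.dist x z = 3}.ncard
  have e4 : n₂ = q ^ 3 + q ^ 4 := by
    simp only [Finset.sum_range_succ, Finset.sum_range_zero] at e1
    omega
  have e5 : (∑ j ∈ Finset.range 3, q ^ j) - ∑ j ∈ Finset.range 2, q ^ j = q ^ 2 := by
    simp only [Finset.sum_range_succ, Finset.sum_range_zero]
    omega
  rw [e5, e4] at e2
  have e6 : n₃ = q ^ 5 := by
    have : 0 < ∑ j ∈ Finset.range 2, q ^ j := by simp [Finset.sum_range_succ]
    refine Nat.eq_of_mul_eq_mul_right this (e2.symm.trans ?_)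
    simp only [Finset.sum_range_succ, Finset.sum_range_zero]
    ring
  rw [Finset.sum_range_succ _ 5, e6]

end IsBallEmbedded

end Hexagon

/-! ### Assembly of the classification. -/

theorem PointLineGeometry.W_eq {P : Type*} {G : PointLineGeometry P}
    (hc : G.pointGraph.Connected) (i : ℕ) (x : G.points) :
    G.W i x = Subtype.val '' {y : G.points | G.pointGraph.dist x y ≤ i} := by
  rw [PointLineGeometry.W]
  congr 1
  ext y
  simp only [Set.mem_ofPred_eq]
  rw [← (hc x y).coe_dist_eq_edist, Nat.cast_le]

theorem theorem3p1 {K V : Type*} [Field K] [Finite K] [AddCommGroup V] [Module K V]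
    [FiniteDimensional K V] (n q d : ℕ)
    (hn : Module.finrank K V = n) (hq : Nat.card K = q)
    (G : PointLineGeometry (ℙ K V))
    (ha : (⨆ p ∈ G.points, p.submodule) = (⊤ : Submodule K V))
    (hb : ∀ L ∈ G.lines, IsProjSubspaceOfDim 2 L)
    (hc : G.points = ⋃ L ∈ G.lines, L)
    (hd : IsMetricallyRegular G.pointGraph ∧ G.pointGraph.ediam = d ∧ 2 ≤ d)
    (he : ∀ x, IsProjSubspace (G.W 1 x))
    (hf : ∀ x, ∀ i ≤ d, ∃ U : Submodule K V, G.W i x = G.points ∩ pointsOf U)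
    (hg : ∀ x, ∃ h : ℕ, (G.W 2 x).ncard = (q ^ h - 1) / (q - 1)) :
    (d = 2 ∧ ∃ π : Submodule K V → Submodule K V, IsSymplecticPolarity π ∧
      (∀ x : ℙ K V, ∃ hx : x ∈ G.points, G.W 1 ⟨x, hx⟩ = pointsOf (π x.submodule)) ∧
      G.points = {x | x.submodule ≤ π x.submodule} ∧
      G.lines = {L | ∃ U : Submodule K V, Module.finrank K U = 2 ∧ U ≤ π U ∧ L = pointsOf U}) ∨
    (d = 3 ∧ G.IsGeneralizedPolygon 6 ∧ G.HasParameters q q ∧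
      (∀ x, IsProjSubspaceOfDim 3 (G.W 1 x)) ∧
      ((∀ x, IsProjSubspace (G.W 2 x) ∧ IsProjSubspace (G.W 3 x)) →
        n = 6 ∧ ∃ π : Submodule K V → Submodule K V, IsSymplecticPolarity π ∧
          ∀ x : ℙ K V, ∃ hx : x ∈ G.points,
            G.W 2 ⟨x, hx⟩ = pointsOf (π x.submodule))) := by
  obtain ⟨hreg, hdiam, hd2⟩ := hd
  have hconn := hreg.connected
  have hWm : ∀ i (x y : G.points), y.1 ∈ G.W i x ↔ G.pointGraph.dist x y ≤ i := by
    intro i x y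
    rw [PointLineGeometry.W_eq hconn, Subtype.val_injective.mem_set_image]
    rfl
  have hWsub : ∀ i (x : G.points), G.W i x ⊆ G.points := by
    rintro i x _ ⟨y, -, rfl⟩
    exact y.2
  have hWcard : ∀ i (x : G.points), (G.W i x).ncard =
      {z : G.points | G.pointGraph.dist x z ≤ i}.ncard := by
    intro i x
    rw [PointLineGeometry.W_eq hconn, Set.ncard_image_of_injective _ Subtype.val_injective]
  choose S hS using he
  have hf' : ∀ (i : ℕ) (x : G.points), ∃ U : Submodule K V,
      i ≤ d → G.W i x = G.points ∩ pointsOf U := by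
    intro i x
    by_cases hi : i ≤ d
    · obtain ⟨U, hU⟩ := hf x i hi
      exact ⟨U, fun _ => hU⟩
    -- A default value beyond the diameter, where nothing is required of the subspace.
    · exact ⟨⊥, fun h => absurd h hi⟩
  choose U hU using hf'
  have hle : ∀ x y, G.pointGraph.dist x y ≤ d := by
    intro x y
    have h1 := SimpleGraph.edist_le_ediam (G := G.pointGraph) (u := x) (v := y)
    rw [hdiam, ← (hconn x y).coe_dist_eq_edist] at h1
    exact_mod_cast h1
  have : Nonempty G.points := hconn.nonempty
  have h : IsBallEmbedded G d S U := by
    refine ⟨hb, hreg, hd2, hle, ?_, ?_, ?_⟩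
    · obtain ⟨x, y, hxy⟩ := SimpleGraph.exists_edist_eq_ediam_of_finite (G := G.pointGraph)
      refine ⟨x, y, ?_⟩
      rw [hdiam, ← (hconn x y).coe_dist_eq_edist] at hxy
      exact_mod_cast hxy
    · intro x p
      rw [← mem_pointsOf, ← hS]
      constructor
      · intro hp
        exact ⟨hWsub _ _ hp, (hWm 1 x ⟨p, hWsub _ _ hp⟩).1 hp⟩
      · rintro ⟨hp, hle⟩
        exact (hWm 1 x ⟨p, hp⟩).2 hle
    · intro i hi x y
      rw [← hWm, hU i x hi]
      exact ⟨fun hy => ⟨y.2, hy⟩, fun hy => hy.2⟩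
  have hVn : Nontrivial V := by
    obtain ⟨x⟩ := hconn.nonempty
    exact ⟨x.1.rep, 0, x.1.rep_nonzero⟩
  subst hq
  have hq2 : 2 ≤ Nat.card K := IsBallEmbedded.two_le_card
  obtain ⟨e, he3, heS, hm, hcase⟩ := h.dimensions (by
    intro x
    obtain ⟨k, hk⟩ := hg x
    exact ⟨k, by rw [← hWcard, hk, Nat.geomSum_eq hq2]⟩)
  rcases hcase with ⟨hf2, hcard⟩ | ⟨hf2, hcard⟩
  · right
    obtain ⟨rfl, rfl, h2, h3⟩ := h.hexagon_dimensions he3 heS hm hf2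
    refine ⟨rfl, h.isGeneralizedHexagon heS hm hf2 h2 h3, h.hasParameters heS,
      fun x => ⟨S x, heS x, hS x⟩, fun hsub => ?_⟩
    choose T hT using fun x => (hsub x).1
    choose T' hT' using fun x => (hsub x).2
    -- The ball of radius three is the whole geometry; being a subspace that spans, it is the whole
    -- space.
    have huniv : G.points = Set.univ := by
      obtain ⟨x⟩ := hconn.nonempty
      have h1 : G.points = pointsOf (T' x) := by
        rw [← hT' x]
        refine Set.Subset.antisymm (fun p hp => ?_) (hWsub 3 x)
        exact (hWm 3 x ⟨p, hp⟩).2 (hle _ _)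
      have h2 : T' x = ⊤ := by
        rw [eq_top_iff, ← ha]
        refine iSup₂_le fun p hp => ?_
        rw [h1] at hp
        exact hp
      rw [h1, h2, pointsOf_top]
    have hn6 : n = 6 := by
      have h1 := h.card_points heS h2 h3 hcard
      rw [huniv, Set.ncard_univ, Projectivization.card_of_finrank K V hn] at h1
      exact IsBallEmbedded.finrank_eq_of_geomSum_eq (K := K) h1
    have hmem : ∀ p : ℙ K V, p ∈ G.points := fun p => huniv ▸ Set.mem_univ p
    have hTm : ∀ x y : G.points, y.1.submodule ≤ T x ↔ G.pointGraph.dist x y ≤ 2 := by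
      intro x y
      rw [← hWm 2 x y, hT x, mem_pointsOf]
    obtain ⟨π, hπ, hπx⟩ := exists_isSymplecticPolarity (fun p => T ⟨p, hmem p⟩)
      (by
        intro p
        have h1 := hcard ⟨p, hmem p⟩
        rw [← hWcard, hT, ncard_pointsOf] at h1
        rw [IsBallEmbedded.finrank_eq_of_geomSum_eq (K := K) h1, hn, hn6])
      (fun p => (hTm ⟨p, hmem p⟩ ⟨p, hmem p⟩).2 (by simp))
      (fun p r hpr => by
        rw [hTm ⟨p, hmem p⟩ ⟨r, hmem r⟩, SimpleGraph.dist_comm] at hpr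
        exact (hTm ⟨r, hmem r⟩ ⟨p, hmem p⟩).2 hpr)
    exact ⟨hn6, π, hπ, fun x => ⟨hmem x, by rw [hπx, hT]⟩⟩
  · left
    obtain rfl := h.diameter_eq_two he3 heS hm hf2
    obtain ⟨hV, huniv⟩ := h.points_eq_univ_of_dist_two he3 heS hm hf2 hcard ha
    have hmem : ∀ p : ℙ K V, p ∈ G.points := fun p => huniv ▸ Set.mem_univ p
    obtain ⟨π, hπ, hπx⟩ := exists_isSymplecticPolarity (fun p => S ⟨p, hmem p⟩)
      (fun p => by rw [heS, hV])
      (fun p => h.self_le_S ⟨p, hmem p⟩)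
      (fun p r hpr => h.le_S_symm (x := ⟨p, hmem p⟩) (y := ⟨r, hmem r⟩) hpr)
    refine ⟨rfl, π, hπ, fun x => ⟨hmem x, by rw [hπx, hS]⟩, ?_, ?_⟩
    · rw [huniv]
      ext x
      simpa [hπx] using h.self_le_S ⟨x, hmem x⟩
    · have hanti := hπ.1.1
      have hinv := hπ.1.2
      ext L
      constructor
      · intro hL
        obtain ⟨M, hM, rfl⟩ := hb L hL
        refine ⟨M, hM, ?_, rfl⟩
        rw [← pointsOf_subset_iff]
        intro p hp
        have h1 : M ≤ π p.submodule := by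
          rw [hπx, ← pointsOf_subset_iff]
          exact h.line_subset_S (x := ⟨p, hmem p⟩) hL hp
        have h2 := hanti _ _ h1
        rwa [hinv] at h2
      · rintro ⟨M, hM, hMπ, rfl⟩
        obtain ⟨p, hp⟩ := exists_point_of_finrank_pos (K := K) (U := M) (by omega)
        obtain ⟨r, hr, hrp⟩ := exists_point_le_not_le (U := M) (U' := p.submodule) fun hle => by
          have := Submodule.finrank_mono hle
          rw [hM, p.finrank_submodule] at this
          omega
        have hpr : p ≠ r := by rintro rfl; exact hrp le_rfl
        -- Total isotropy puts `r` in the polar hyperplane of `p`, which is its unit ball, so `p`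
        -- and `r` are collinear in the geometry.
        have h1 : r.submodule ≤ S ⟨p, hmem p⟩ := by
          rw [← hπx]
          exact (hr.trans hMπ).trans (hanti _ _ hp)
        rw [eq_sup_of_finrank_two hM hpr hp hr]
        exact h.pointsOf_sup_mem_lines (x := ⟨p, hmem p⟩) (y := ⟨r, hmem r⟩)
          (h.dist_eq_one (fun he => hpr (congrArg Subtype.val he)) h1)
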